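/- Terms are formal expressions in variables $x_0,x_1,x_2,\dots$. Semigroup terms use one binary operation, and group terms use the operations $\cdot$, ${}^{-1}$, $1$. For a semigroup $A$, $\mathrm{TERM\text{-}EQ}(A)$ is the decision problem whose instances are the pairs $(p,q)$ of semigroup terms and whose question is whether $p$ and $q$ induce the same function on $A$. For a group $G$, $\mathrm{TERM\text{-}EQ}(G)$ is the same problem with group terms. Instances are written as strings over a fixed finite alphabet, with the indices of the variables in binary. For decision problems, $A\le_P B$ means that there is a polynomial-time many-one reduction of $A$ to $B$, and $A\equiv_P B$ means that $A\le_P B$ and $B\le_P A$. For a group $G$ and a matrix $M$ with entries in $G\cup\{0\}$, rows indexed by $\Lambda$ and columns indexed by $I$, the Rees matrix semigroup $\mathcal M(G;M)$ consists of a zero element $0$ and the triples $[i,g,\lambda]$ ($i\in I$, $g\in G$, $\lambda\in\Lambda$), with $[i,g,\lambda][j,h,\mu]=[i,gM(\lambda,j)h,\mu]$ if $M(\lambda,j)\ne 0$ and $[i,g,\lambda][j,h,\mu]=0$ if $M(\lambda,j)=0$. The translational hull $\Omega(S)$ of a semigroup $S$ is the semigroup of all pairs $(\ell,r)$ of maps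 $S\to S$ such that $\ell(xy)=\ell(x)y$, $r(xy)=x\,r(y)$ and $x\,\ell(y)=r(x)\,y$ for all $x,y\in S$, with the product $(\ell,r)(\ell',r')=(\ell\circ\ell',\,r'\circ r)$. **Lemma 5.5.** Let $M=\begin{pmatrix}0&1\\1&1\end{pmatrix}$, let $G$ be a finite group, and let $S=\mathcal M(G;M)$. 1. If $G$ is nontrivial, then $\mathrm{TERM\text{-}EQ}(\Omega(S))\equiv_P \mathrm{TERM\text{-}EQ}(G)$. 2. If $G$ is trivial, then $\mathrm{TERM\text{-}EQ}(G)\le_P\mathrm{TERM\text{-}EQ}(\Omega(S))$ and $\mathrm{TERM\text{-}EQ}(\Omega(S))$ is in P (so that both problems are in P). -/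

import Mathlib

universe u v w

/-! ### Decision problems, polynomial time, polynomial-time reductions -/

/-- A decision problem: instances, written as strings over an alphabet, and the set of
yes-instances. -/
structure DecisionProblem where
  /-- the instances -/
  Inst : Type
  /-- the alphabet over which instances are written -/
  Alphabet : Type
  /-- the string presented to a machine for a given instance -/
  encode : Inst → List Alphabet
  /-- the yes-instances -/
  Yes : Inst → Prop

/-- Polynomial-time many-one reducibility `A ≤_P B`: a function from instances of `A` to instances
of `B`, computed by a Turing machine in time polynomial in the length of the input string, under
which yes-instances correspond to yes-instances and no-instances to no-instances. -/
def DecisionProblem.PolyReducible (A B : DecisionProblem) : Prop :=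
  ∃ f : A.Inst → B.Inst,
    Nonempty (Turing.TM2ComputableInPolyTime A.encode B.encode f) ∧ ∀ a, A.Yes a ↔ B.Yes (f a)

/-- Polynomial equivalence `A ≡_P B`. -/
def DecisionProblem.PolyEquivalent (A B : DecisionProblem) : Prop :=
  A.PolyReducible B ∧ B.PolyReducible A

/-- The class P: some Turing machine outputs the correct answer, as one bit, in polynomial time. -/
def DecisionProblem.InP (A : DecisionProblem) : Prop :=
  ∃ f : A.Inst → Bool,
    Nonempty (Turing.TM2ComputableInPolyTime A.encode Computability.encodeBool f) ∧
      ∀ a, A.Yes a ↔ f a = true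

/-! ### Terms and the term-equivalence problem -/

/-- The symbols with which pairs of terms are written. The variable `x_n` is written as the symbol
`var` followed by the binary digits of `n`. -/
inductive TermSymbol : Type
  | mul
  | inv
  | one
  | var
  | bit (b : Bool)
  | sep

/-- The string for the variable `x_n`. -/
def encodeVar (n : ℕ) : List TermSymbol :=
  TermSymbol.var :: (Computability.encodeNat n).map TermSymbol.bit

/-- Semigroup terms: terms in the variables `x_0, x_1, …` and one binary operation. -/
inductive SemigroupTerm : Type
  | var (n : ℕ)
  | mul (p q : SemigroupTerm)

/-- The value of a semigroup term under an assignment of elements to the variables. -/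
def SemigroupTerm.eval {A : Type u} [Mul A] (e : ℕ → A) : SemigroupTerm → A
  | .var n => e n
  | .mul p q => p.eval e * q.eval e

/-- Semigroup terms in Polish (prefix) notation. -/
def SemigroupTerm.encode : SemigroupTerm → List TermSymbol
  | .var n => encodeVar n
  | .mul p q => TermSymbol.mul :: (p.encode ++ q.encode)

/-- Group terms: terms in the variables `x_0, x_1, …` and the operations of a group `(G; ·, ⁻¹, 1)`. -/
inductive GroupTerm : Type
  | var (n : ℕ)
  | one
  | inv (p : GroupTerm)
  | mul (p q : GroupTerm)

/-- The value of a group term under an assignment of elements to the variables. -/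
def GroupTerm.eval {G : Type u} [Group G] (e : ℕ → G) : GroupTerm → G
  | .var n => e n
  | .one => 1
  | .inv p => (p.eval e)⁻¹
  | .mul p q => p.eval e * q.eval e

/-- Group terms in Polish (prefix) notation. -/
def GroupTerm.encode : GroupTerm → List TermSymbol
  | .var n => encodeVar n
  | .one => [TermSymbol.one]
  | .inv p => TermSymbol.inv :: p.encode
  | .mul p q => TermSymbol.mul :: (p.encode ++ q.encode)

/-- The term-equivalence problem of a semigroup `A`: given two semigroup terms, do they induce the
same function on `A`? -/
def semigroupTermEq (A : Type u) [Semigroup A] : DecisionProblem where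
  Inst := SemigroupTerm × SemigroupTerm
  Alphabet := TermSymbol
  encode pq := pq.1.encode ++ TermSymbol.sep :: pq.2.encode
  Yes pq := ∀ e : ℕ → A, pq.1.eval e = pq.2.eval e

/-- The term-equivalence problem of a group `G`: given two group terms, do they induce the same
function on `G`? -/
def groupTermEq (G : Type u) [Group G] : DecisionProblem where
  Inst := GroupTerm × GroupTerm
  Alphabet := TermSymbol
  encode pq := pq.1.encode ++ TermSymbol.sep :: pq.2.encode
  Yes pq := ∀ e : ℕ → G, pq.1.eval e = pq.2.eval e

/-! ### The translational hull of a semigroup -/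

/-- An element of the translational hull `Ω(S)`: a linked pair consisting of a left translation and
a right translation of `S`. -/
@[ext]
structure TranslationalHull (S : Type u) [Semigroup S] where
  /-- the left translation -/
  left : S → S
  /-- the right translation -/
  right : S → S
  left_mul : ∀ x y, left (x * y) = left x * y
  right_mul : ∀ x y, right (x * y) = x * right y
  linked : ∀ x y, x * left y = right x * y

/-- Left translations are composed as functions written on the left of their arguments, right
translations as functions written on the right. -/
instance TranslationalHull.instSemigroup (S : Type u) [Semigroup S] :
    Semigroup (TranslationalHull S) where
  mul a b :=
    { left := fun x => a.left (b.left x)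
      right := fun x => b.right (a.right x)
      left_mul := fun x y => by rw [b.left_mul, a.left_mul]
      right_mul := fun x y => by rw [a.right_mul, b.right_mul]
      linked := fun x y => by rw [a.linked, b.linked] }
  mul_assoc _ _ _ := rfl

/-! ### Rees matrix semigroups -/

/-- The Rees matrix semigroup `𝓜(G; M)` (with zero) of a matrix `M` over `G ∪ {0}`, with rows
indexed by `L` and columns indexed by `I`: the elements are `0` and the triples `[i, g, l]`. -/
inductive ReesMatrixSemigroup {G : Type u} {L : Type v} {I : Type w}
    (M : Matrix L I (WithZero G)) : Type (max u v w)
  | zero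
  | triple (i : I) (g : G) (l : L)

/-- The product: `[i, g, l] [j, h, k]` is `[i, g M(l, j) h, k]` if `M(l, j) ≠ 0`, and `0` if
`M(l, j) = 0`; and `0` is a zero element. -/
def ReesMatrixSemigroup.mul {G : Type u} [Group G] {L : Type v} {I : Type w}
    {M : Matrix L I (WithZero G)} :
    ReesMatrixSemigroup M → ReesMatrixSemigroup M → ReesMatrixSemigroup M
  | .triple i g l, .triple j h k =>
    match M l j with
    | none => .zero
    | some a => .triple i (g * a * h) k
  | _, _ => .zero

instance ReesMatrixSemigroup.instSemigroup {G : Type u} [Group G] {L : Type v} {I : Type w}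
    (M : Matrix L I (WithZero G)) : Semigroup (ReesMatrixSemigroup M) where
  mul := ReesMatrixSemigroup.mul
  mul_assoc := by
    intro a b c
    change ReesMatrixSemigroup.mul (ReesMatrixSemigroup.mul a b) c =
      ReesMatrixSemigroup.mul a (ReesMatrixSemigroup.mul b c)
    rcases a with _ | ⟨i, g, l⟩ <;> rcases b with _ | ⟨j, h, k⟩ <;> rcases c with _ | ⟨m, f, n⟩ <;>
      try rfl
    · rcases h1 : M l j with _ | a <;> simp [ReesMatrixSemigroup.mul, h1]
    · rcases h1 : M l j with _ | a <;> rcases h2 : M k m with _ | b <;>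
        simp [ReesMatrixSemigroup.mul, h1, h2, mul_assoc]

/-- The `2 × 2` matrix over `G ∪ {0}` whose upper left entry is `0` and whose other entries
are `1`. -/
def cornerZeroMatrix (G : Type u) [Group G] : Matrix (Fin 2) (Fin 2) (WithZero G) :=
  !![0, 1; 1, 1]

/-! The translational hull of `𝓜(G; M)` is the semigroup itself with `G` adjoined as a group of
units: its elements are zero, the units `g`, and the triples `[i, g, l]` (`toHull_mul`,
`toHull_injective`, `toHull_surjective`). All nonzero entries of the matrix are `1`, so a product
that does not vanish has as group component the product of the group components
(`groupPart_evalWord`). A product vanishes exactly when some letter is zero or some triple ending in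
index `0` is followed, after units only, by a triple beginning with index `0`
(`evalWord_eq_none_iff`).

Hence an identity of the hull splits into two independent conditions: the identity holds in `G`, and
both sides vanish under the same assignments, even after being multiplied on both sides by `[i, 1,
l]`. The second condition does not involve `G`. With an end marker put at both ends of each word, it
says that every factor `x w y` of one word is matched in the other by a factor from `x` to `y` whose
inner letters all occur in `w`, and conversely (`forall_eval_eq_iff_factorsCovered`). This is
decided by scanning one word for each pair of positions of the other (`covered_eq_true_iff`).

So a pair of semigroup terms is passed on unchanged to `G` if coverage holds, and is replaced by a
false identity of `G` otherwise; a false identity exists when `G` is nontrivial. For trivial `G`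
coverage alone is the answer. In the other direction, `s = t` is turned into `w ^ 3 * x_0 = w ^ 2 *
x_0`, where `w` is a positive word for `s * t⁻¹`, inverses being replaced by powers with exponent
`|G| - 1` (`powerPair_correct`).

The polynomial time bounds are proved for actual machines. Programs with sequencing, branching and
loops over finitely many stacks have a big-step semantics with step counts, and are compiled to
stack machines once and for all (`computableInPolyTime_of_exec`); the algorithms are then written
and timed as such programs. -/

/-! ### Structured stack programs -/

namespace StackProgram

open Turing

/-- The contents of the stacks of a program: an input stack, an output stack and work stacks. -/
structure Store (ι ω W C : Type) where
  /-- the input stack -/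
  inp : List ι
  /-- the output stack -/
  out : List ω
  /-- the work stacks -/
  wk : W → List C

/-- Loop-free programs over a finite state `σ`; each is executed in one step of a machine. -/
inductive Block (σ ι ω W C : Type) : Type
  | done
  | load (f : σ → σ) (b : Block σ ι ω W C)
  | read (f : σ → Option ι → σ) (b : Block σ ι ω W C)
  | write (f : σ → ω) (b : Block σ ι ω W C)
  | push (w : W) (f : σ → C) (b : Block σ ι ω W C)
  | pop (w : W) (f : σ → Option C → σ) (b : Block σ ι ω W C)
  | branch (c : σ → Bool) (b b' : Block σ ι ω W C)

variable {σ ι ω W C : Type} [DecidableEq W]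

/-- The effect of a block. -/
@[simp]
def Block.eval : Block σ ι ω W C → σ → Store ι ω W C → σ × Store ι ω W C
  | .done, v, S => (v, S)
  | .load f b, v, S => b.eval (f v) S
  | .read f b, v, S => b.eval (f v S.inp.head?) ⟨S.inp.tail, S.out, S.wk⟩
  | .write f b, v, S => b.eval v ⟨S.inp, f v :: S.out, S.wk⟩
  | .push w f b, v, S => b.eval v ⟨S.inp, S.out, Function.update S.wk w (f v :: S.wk w)⟩
  | .pop w f b, v, S =>
    b.eval (f v (S.wk w).head?) ⟨S.inp, S.out, Function.update S.wk w (S.wk w).tail⟩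
  | .branch c b b', v, S => if c v then b.eval v S else b'.eval v S

/-- Programs built from blocks by sequencing, case distinction and while loops. -/
inductive Prog (σ ι ω W C : Type) : Type
  | blk (b : Block σ ι ω W C)
  | seq (P Q : Prog σ ι ω W C)
  | ite (c : σ → Bool) (P Q : Prog σ ι ω W C)
  | loop (c : σ → Bool) (P : Prog σ ι ω W C)

/-- `Exec P v S v' S' t`: the program `P`, started in state `v` with store `S`, stops in state `v'`
with store `S'` after at most `t` steps. -/
inductive Exec : Prog σ ι ω W C → σ → Store ι ω W C → σ → Store ι ω W C → ℕ → Prop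
  | blk (b v S) : Exec (.blk b) v S (b.eval v S).1 (b.eval v S).2 1
  | seq {P Q v S v' S' v'' S'' t t'} : Exec P v S v' S' t → Exec Q v' S' v'' S'' t' →
      Exec (.seq P Q) v S v'' S'' (t + t')
  | ite_true {c P Q v S v' S' t} : c v = true → Exec P v S v' S' t →
      Exec (.ite c P Q) v S v' S' (t + 1)
  | ite_false {c P Q v S v' S' t} : c v = false → Exec Q v S v' S' t →
      Exec (.ite c P Q) v S v' S' (t + 1)
  | loop_false {c P v S} : c v = false → Exec (.loop c P) v S v S 1
  | loop_true {c P v S v' S' v'' S'' t t'} : c v = true → Exec P v S v' S' t →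
      Exec (.loop c P) v' S' v'' S'' t' → Exec (.loop c P) v S v'' S'' (t + t' + 1)
  | mono {P v S v' S' t t'} : Exec P v S v' S' t → t ≤ t' → Exec P v S v' S' t'

/-- The program points of a program. -/
def Prog.Label : Prog σ ι ω W C → Type
  | .blk _ => Unit
  | .seq P Q => P.Label ⊕ Q.Label
  | .ite _ P Q => Option (P.Label ⊕ Q.Label)
  | .loop _ P => Option P.Label

/-- There are finitely many program points. -/
def Prog.fintypeLabel : (P : Prog σ ι ω W C) → Fintype P.Label
  | .blk _ => inferInstanceAs (Fintype Unit)
  | .seq P Q =>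
    letI := P.fintypeLabel
    letI := Q.fintypeLabel
    inferInstanceAs (Fintype (P.Label ⊕ Q.Label))
  | .ite _ P Q =>
    letI := P.fintypeLabel
    letI := Q.fintypeLabel
    inferInstanceAs (Fintype (Option (P.Label ⊕ Q.Label)))
  | .loop _ P =>
    letI := P.fintypeLabel
    inferInstanceAs (Fintype (Option P.Label))

/-- The program point where the execution of a program starts. -/
def Prog.entry : (P : Prog σ ι ω W C) → P.Label
  | .blk _ => ()
  | .seq P _ => Sum.inl P.entry
  | .ite _ _ _ => none
  | .loop _ _ => none

/-- The alphabets of the stacks. -/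
abbrev StackAlphabet (ι ω W C : Type) : Option (Option W) → Type
  | none => ι
  | some none => ω
  | some (some _) => C

/-- The stacks of a machine with a given store. -/
def Store.stacks (S : Store ι ω W C) : (k : Option (Option W)) → List (StackAlphabet ι ω W C k)
  | none => S.inp
  | some none => S.out
  | some (some w) => S.wk w

/-- The machine statement executing a block and continuing with another statement. -/
def Block.stmt {Λ : Type} (q : TM2.Stmt (StackAlphabet ι ω W C) Λ σ) :
    Block σ ι ω W C → TM2.Stmt (StackAlphabet ι ω W C) Λ σ
  | .done => q
  | .load f b => .load f (b.stmt q)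
  | .read f b => .pop none f (b.stmt q)
  | .write f b => .push (some none) f (b.stmt q)
  | .push w f b => .push (some (some w)) f (b.stmt q)
  | .pop w f b => .pop (some (some w)) f (b.stmt q)
  | .branch c b b' => .branch c (b.stmt q) (b'.stmt q)

/-- One machine step runs a statement up to its next jump. A block contains no jump, so all its
stack operations are carried out before control reaches `q`; this is why a block costs one unit of
time. -/
theorem Block.stepAux_stmt {Λ : Type} (q : TM2.Stmt (StackAlphabet ι ω W C) Λ σ)
    (b : Block σ ι ω W C) (v : σ) (S : Store ι ω W C) :
    TM2.stepAux (b.stmt q) v S.stacks = TM2.stepAux q (b.eval v S).1 (b.eval v S).2.stacks := by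
  induction b generalizing v S with
  | done => rfl
  | load f b ih => exact ih _ _
  | read f b ih =>
    rw [Block.stmt, TM2.stepAux, Block.eval, ← ih]
    congr 1
    funext k
    rcases k with _ | _ | w <;> simp [Store.stacks]
  | write f b ih =>
    rw [Block.stmt, TM2.stepAux, Block.eval, ← ih]
    congr 1
    funext k
    rcases k with _ | _ | w <;> simp [Store.stacks]
  | push w f b ih =>
    rw [Block.stmt, TM2.stepAux, Block.eval, ← ih]
    congr 1
    funext k
    rcases k with _ | _ | w'
    · simp [Store.stacks]
    · simp [Store.stacks]
    · by_cases h : w' = w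
      · subst h; simp [Store.stacks]
      · simp [Store.stacks, h]
  | pop w f b ih =>
    rw [Block.stmt, TM2.stepAux, Block.eval, ← ih]
    congr 1
    funext k
    rcases k with _ | _ | w'
    · simp [Store.stacks]
    · simp [Store.stacks]
    · by_cases h : w' = w
      · subst h; simp [Store.stacks]
      · simp [Store.stacks, h]
  | branch c b b' ih ih' =>
    rw [Block.stmt, TM2.stepAux, Block.eval]
    cases c v
    · exact ih' _ _
    · exact ih _ _

/-- The machine code of a program whose points are embedded into a type of labels, and which is to
be left through the label `ex`. -/
def Prog.code {Λ : Type} : (P : Prog σ ι ω W C) → (P.Label → Λ) → Λ → P.Label →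
    TM2.Stmt (StackAlphabet ι ω W C) Λ σ
  | .blk b, _, ex, _ => b.stmt (.goto fun _ => ex)
  | .seq P Q, emb, _, .inl l => P.code (fun l => emb (.inl l)) (emb (.inr Q.entry)) l
  | .seq _ Q, emb, ex, .inr l => Q.code (fun l => emb (.inr l)) ex l
  | .ite c P Q, emb, _, none =>
    .branch c (.goto fun _ => emb (some (.inl P.entry))) (.goto fun _ => emb (some (.inr Q.entry)))
  | .ite _ P _, emb, ex, some (.inl l) => P.code (fun l => emb (some (.inl l))) ex l
  | .ite _ _ Q, emb, ex, some (.inr l) => Q.code (fun l => emb (some (.inr l))) ex l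
  | .loop c P, emb, ex, none =>
    .branch c (.goto fun _ => emb (some P.entry)) (.goto fun _ => ex)
  | .loop _ P, emb, _, some l => P.code (fun l => emb (some l)) (emb none) l

/-- A transition system gets from one configuration to another in at most `t` steps. -/
def ReachesIn {X : Type} (f : X → Option X) (a b : X) (t : ℕ) : Prop :=
  ∃ n ≤ t, (flip bind f)^[n] (some a) = some b

theorem ReachesIn.trans {X : Type} {f : X → Option X} {a b c : X} {t t' : ℕ}
    (h : ReachesIn f a b t) (h' : ReachesIn f b c t') : ReachesIn f a c (t + t') := by
  obtain ⟨n, hn, e⟩ := h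
  obtain ⟨n', hn', e'⟩ := h'
  exact ⟨n' + n, by omega, by rw [Function.iterate_add_apply, e, e']⟩

theorem ReachesIn.single {X : Type} {f : X → Option X} {a b : X} (h : f a = some b) :
    ReachesIn f a b 1 :=
  ⟨1, le_rfl, h⟩

theorem ReachesIn.mono {X : Type} {f : X → Option X} {a b : X} {t t' : ℕ}
    (h : ReachesIn f a b t) (h' : t ≤ t') : ReachesIn f a b t' := by
  obtain ⟨n, hn, e⟩ := h
  exact ⟨n, hn.trans h', e⟩

/-- Correctness of the compilation. The embedding and the exit label have to vary in the induction:
the first half of a sequence exits to the entry of the second half, and the body of a loop exits to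
the loop test. -/
theorem Exec.reachesIn {Λ : Type} {M : Λ → TM2.Stmt (StackAlphabet ι ω W C) Λ σ}
    {P : Prog σ ι ω W C} {v S v' S' t} (h : Exec P v S v' S' t) (emb : P.Label → Λ) (ex : Λ)
    (hM : ∀ l, M (emb l) = P.code emb ex l) :
    ReachesIn (TM2.step M) ⟨some (emb P.entry), v, S.stacks⟩ ⟨some ex, v', S'.stacks⟩ t := by
  induction h generalizing ex with
  | blk b v S =>
    refine ReachesIn.single ?_
    rw [TM2.step, hM, Prog.code, Block.stepAux_stmt]
    rfl
  | seq _ _ ih ih' =>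
    exact (ih _ _ fun l => hM (.inl l)).trans (ih' (fun l => emb (.inr l)) _ fun l => hM (.inr l))
  | ite_true hc _ ih =>
    rw [add_comm]
    refine (ReachesIn.single ?_).trans
      (ih (fun l => emb (some (.inl l))) _ fun l => hM (some (.inl l)))
    rw [TM2.step, hM]
    simp [Prog.code, Prog.entry, hc]
  | ite_false hc _ ih =>
    rw [add_comm]
    refine (ReachesIn.single ?_).trans
      (ih (fun l => emb (some (.inr l))) _ fun l => hM (some (.inr l)))
    rw [TM2.step, hM]
    simp [Prog.code, Prog.entry, hc]
  | loop_false hc =>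
    refine ReachesIn.single ?_
    rw [TM2.step, hM]
    simp [Prog.code, Prog.entry, hc]
  | loop_true hc _ _ ih ih' =>
    rw [add_comm]
    refine (ReachesIn.single ?_).trans
      ((ih (fun l => emb (some l)) (emb none) fun l => hM (some l)).trans (ih' emb ex hM))
    rw [TM2.step, hM]
    simp [Prog.code, Prog.entry, hc]
  | mono _ ht ih => exact (ih emb ex hM).mono ht

/-- The Turing machine running a program. -/
def Prog.machine [Fintype σ] [Fintype ι] [Fintype W] (P : Prog σ ι ω W C) (v₀ : σ) : FinTM2 where
  K := Option (Option W)
  k₀ := none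
  k₁ := some none
  Γ := StackAlphabet ι ω W C
  Λ := Option P.Label
  main := some P.entry
  ΛFin := letI := P.fintypeLabel; inferInstance
  σ := σ
  initialState := v₀
  Γk₀Fin := inferInstanceAs (Fintype ι)
  m
    | some l => P.code some none l
    | none => .load (fun _ => v₀) .halt

/-- A program which, within a number of steps that is polynomial in the length of its input, writes
the value of a function and empties all other stacks yields a polynomial-time Turing machine. -/
theorem computableInPolyTime_of_exec [Fintype σ] [Fintype ι] [Fintype W] {α β : Type}
    {ea : α → List ι} {eb : β → List ω} {f : α → β} (P : Prog σ ι ω W C) (v₀ : σ)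
    (p : Polynomial ℕ)
    (h : ∀ a, ∃ v', Exec P v₀ ⟨ea a, [], fun _ => []⟩ v' ⟨[], eb (f a), fun _ => []⟩
      (p.eval (ea a).length)) :
    Nonempty (TM2ComputableInPolyTime ea eb f) := by
  refine ⟨⟨⟨P.machine v₀, Equiv.refl _, Equiv.refl _⟩, p + 1, fun a => ?_⟩⟩
  have key : ReachesIn (P.machine v₀).step (initList (P.machine v₀) (ea a))
      (haltList (P.machine v₀) (eb (f a))) ((p + 1).eval (ea a).length) := by
    obtain ⟨v', hv⟩ := h a
    have h1 := hv.reachesIn (M := (P.machine v₀).m) some none fun l => rfl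
    rw [Polynomial.eval_add, Polynomial.eval_one]
    have e1 : initList (P.machine v₀) (ea a) =
        ⟨some (some P.entry), v₀, Store.stacks ⟨ea a, [], fun _ => []⟩⟩ := by
      unfold initList
      congr 1
      funext k
      rcases k with _ | _ | w <;> rfl
    have e2 : haltList (P.machine v₀) (eb (f a)) =
        ⟨none, v₀, Store.stacks ⟨[], eb (f a), fun _ => []⟩⟩ := by
      unfold haltList
      congr 1
      funext k
      rcases k with _ | _ | w <;> rfl
    rw [e1, e2]
    -- The additional step runs the exit label, which resets the state to `v₀`, since `haltList`
    -- demands the initial state.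
    exact h1.trans (ReachesIn.single rfl)
  have e1 : (ea a).map (Equiv.refl ι).invFun = ea a := List.map_id _
  have e2 : (eb (f a)).map (Equiv.refl ω).invFun = eb (f a) := List.map_id _
  refine Classical.choice ?_
  obtain ⟨n, hn, e⟩ := key
  refine ⟨⟨⟨n, ?_⟩, hn⟩⟩
  erw [e1, e2]
  exact e

end StackProgram

/-! ### Basic stack routines: transferring, clearing, repeating -/

namespace StackProgram

section Macros

variable {F ι ω W C : Type} [DecidableEq W]

theorem Exec.congr {σ : Type} {P : Prog σ ι ω W C} {v S v' S' t v'' S'' t'}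
    (h : Exec P v S v' S' t) (hv : v' = v'') (hS : S' = S'') (ht : t ≤ t') :
    Exec P v S v'' S'' t' := by
  subst hv hS
  exact h.mono ht

theorem Exec.block {σ : Type} {b : Block σ ι ω W C} {v S v' S'} (h : b.eval v S = (v', S')) :
    Exec (.blk b) v S v' S' 1 := by
  have := Exec.blk b v S
  rwa [h] at this

/-- Store the popped symbol in the register. -/
@[simp]
def setReg (v : Option C × F) (o : Option C) : Option C × F := (o, v.2)

/-- Pop symbols from stack `a` up to and including the first one satisfying `isEnd` (or until the
stack is empty), and push the images under `g` of those before it onto stack `b`. The last symbol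
popped stays in the register. -/
def transfer [Inhabited C] (a b : W) (isEnd : C → Bool) (g : C → C) : Prog (Option C × F) ι ω W C :=
  .seq (.blk (.pop a setReg .done))
    (.loop (fun v => v.1.elim false fun c => !isEnd c)
      (.blk (.push b (fun v => g (v.1.getD default)) (.pop a setReg .done))))

theorem exec_transfer [Inhabited C] {a b : W} (hab : a ≠ b) {isEnd : C → Bool} {g : C → C}
    (s r : List C) (hs : ∀ c ∈ s, isEnd c = false) (hr : ∀ c ∈ r.head?, isEnd c = true)
    (v : Option C × F) (S : Store ι ω W C) (hS : S.wk a = s ++ r) :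
    Exec (transfer a b isEnd g) v S (r.head?, v.2)
      ⟨S.inp, S.out, Function.update (Function.update S.wk a r.tail) b
        ((s.map g).reverse ++ S.wk b)⟩ (2 * s.length + 2) := by
  -- Loop invariant: the head of what remains is in the register, so stack `a` itself holds only the
  -- tail.
  have key : ∀ (s : List C) (B : List C), (∀ c ∈ s, isEnd c = false) →
      Exec (.loop (fun v : Option C × F => v.1.elim false fun c => !isEnd c)
        (.blk (.push b (fun v => g (v.1.getD default)) (.pop a setReg .done))))
        ((s ++ r).head?, v.2)
        ⟨S.inp, S.out, Function.update (Function.update S.wk a (s ++ r).tail) b B⟩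
        (r.head?, v.2) ⟨S.inp, S.out, Function.update (Function.update S.wk a r.tail) b
          ((s.map g).reverse ++ B)⟩ (2 * s.length + 1) := by
    intro s
    induction s with
    | nil =>
      intro B _
      refine (Exec.loop_false ?_).congr rfl (by simp) (by simp)
      rcases h : r.head? with _ | c
      · simp [h]
      · simp [h, hr c (by simp [h])]
    | cons c s ih =>
      intro B hs
      refine (Exec.loop_true ?_ (Exec.block ?_) (ih (g c :: B) fun d hd => hs d (by simp [hd]))).congr
        rfl (by simp) (by simp; omega)
      · simp [hs c (by simp)]
      · have hba := hab.symm
        refine Prod.ext ?_ (congrArg (Store.mk _ _) (funext fun k => ?_))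
        · simp [hab]
        · by_cases h1 : k = a
          · subst h1
            simp [hab]
          · by_cases h2 : k = b
            · subst h2
              simp [h1]
            · simp [h1, h2]
  have h := key s (S.wk b) hs
  rw [← hS, Function.update_eq_self_iff.2] at h
  · exact (Exec.seq (Exec.block rfl) h).congr rfl rfl (by omega)
  · simp [hab.symm]

/-- Move the contents of stack `a` onto stack `b`. -/
def move [Inhabited C] (a b : W) : Prog (Option C × F) ι ω W C :=
  transfer a b (fun _ => false) id

theorem exec_move [Inhabited C] {a b : W} (hab : a ≠ b) (v : Option C × F) (S : Store ι ω W C) :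
    Exec (move a b) v S (none, v.2)
      ⟨S.inp, S.out, Function.update (Function.update S.wk a []) b
        ((S.wk a).reverse ++ S.wk b)⟩ (2 * (S.wk a).length + 2) := by
  have := exec_transfer (F := F) (ι := ι) (ω := ω) (g := id) hab (isEnd := fun _ => false) (S.wk a) []
    (by simp) (by simp) v S (by simp)
  simpa [move] using this

/-- Empty a stack. -/
def clear (a : W) : Prog (Option C × F) ι ω W C :=
  .seq (.blk (.pop a setReg .done)) (.loop (fun v => v.1.isSome) (.blk (.pop a setReg .done)))

theorem exec_clear (a : W) (v : Option C × F) (S : Store ι ω W C) :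
    Exec (clear a) v S (none, v.2) ⟨S.inp, S.out, Function.update S.wk a []⟩
      (2 * (S.wk a).length + 2) := by
  have key : ∀ s : List C,
      Exec (.loop (fun v : Option C × F => v.1.isSome) (.blk (.pop a setReg .done)))
        (s.head?, v.2) ⟨S.inp, S.out, Function.update S.wk a s.tail⟩
        (none, v.2) ⟨S.inp, S.out, Function.update S.wk a []⟩ (2 * s.length + 1) := by
    intro s
    induction s with
    | nil => exact Exec.loop_false rfl
    | cons c s ih =>
      refine (Exec.loop_true rfl (Exec.block ?_) ih).congr rfl rfl (by simp; omega)
      simp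
  exact (Exec.seq (Exec.block rfl) (key (S.wk a))).congr rfl rfl (by omega)

/-- Execute a program a fixed number of times. -/
def repeatProg {σ : Type} (P : Prog σ ι ω W C) : ℕ → Prog σ ι ω W C
  | 0 => .blk .done
  | n + 1 => .seq P (repeatProg P n)

end Macros

end StackProgram

/-! ### The translational hull of `𝓜(G; M)` -/

namespace CornerZero

/-- Normal forms for the elements of the translational hull of `𝓜(G; M)`: a zero element, the
units `(g, none)`, and the elements `(g, some (i, l))` corresponding to the triples `[i, g, l]`. -/
abbrev HullElement (G : Type u) : Type u := Option (G × Option (Fin 2 × Fin 2))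

section

variable {G : Type u} [Group G]

/-- The product of normal forms. -/
def hullMul : HullElement G → HullElement G → HullElement G
  | some (g, none), some (h, t) => some (g * h, t)
  | some (g, some a), some (h, none) => some (g * h, some a)
  | some (g, some (i, l)), some (h, some (j, m)) =>
    if l = 0 ∧ j = 0 then none else some (g * h, some (i, m))
  | some _, none => none
  | none, _ => none

/-- The Rees matrix semigroup `𝓜(G; M)`. -/
abbrev Rees (G : Type u) [Group G] : Type u := ReesMatrixSemigroup (cornerZeroMatrix G)

/-- The group components simply multiply because every nonzero matrix entry is `1`. -/
theorem triple_mul_triple (i j l m : Fin 2) (g h : G) :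
    (ReesMatrixSemigroup.triple i g l * ReesMatrixSemigroup.triple j h m : Rees G) =
      if l = 0 ∧ j = 0 then .zero else .triple i (g * h) m := by
  change ReesMatrixSemigroup.mul _ _ = _
  have e1 : (1 : WithZero G) = some 1 := rfl
  have e0 : (0 : WithZero G) = none := rfl
  fin_cases l <;> fin_cases j <;> simp [ReesMatrixSemigroup.mul, cornerZeroMatrix, e1, e0]

theorem zero_mul' (x : Rees G) : (ReesMatrixSemigroup.zero * x : Rees G) = .zero := by
  cases x <;> rfl

theorem mul_zero' (x : Rees G) : (x * ReesMatrixSemigroup.zero : Rees G) = .zero := by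
  cases x <;> rfl

/-- The left translation belonging to a normal form. -/
def leftTranslation : HullElement G → Rees G → Rees G
  | some (g, none), .triple j h m => .triple j (g * h) m
  | some (g, some (i, l)), .triple j h m => if l = 0 ∧ j = 0 then .zero else .triple i (g * h) m
  | _, _ => .zero

/-- The right translation belonging to a normal form. -/
def rightTranslation : HullElement G → Rees G → Rees G
  | some (g, none), .triple j h m => .triple j (h * g) m
  | some (g, some (i, l)), .triple j h m => if m = 0 ∧ i = 0 then .zero else .triple j (h * g) l
  | _, _ => .zero

/-- The element of the translational hull with a given normal form. -/
def toHull (a : HullElement G) : TranslationalHull (Rees G) where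
  left := leftTranslation a
  right := rightTranslation a
  left_mul x y := by
    rcases x with _ | ⟨i, g, l⟩
    · rcases a with _ | ⟨h, _ | ⟨j, m⟩⟩ <;> simp [leftTranslation, zero_mul']
    rcases y with _ | ⟨i', g', l'⟩
    · rcases a with _ | ⟨h, _ | ⟨j, m⟩⟩ <;> simp [leftTranslation, mul_zero']
    rcases a with _ | ⟨h, _ | ⟨j, m⟩⟩
    · simp [leftTranslation, zero_mul']
    · simp only [leftTranslation, triple_mul_triple]
      split_ifs <;> simp [mul_assoc]
    · simp only [leftTranslation, triple_mul_triple]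
      split_ifs <;> simp_all [mul_assoc, triple_mul_triple, zero_mul'] <;>
        split_ifs <;> tauto
  right_mul x y := by
    rcases y with _ | ⟨i', g', l'⟩
    · rcases a with _ | ⟨h, _ | ⟨j, m⟩⟩ <;> simp [rightTranslation, mul_zero']
    rcases x with _ | ⟨i, g, l⟩
    · rcases a with _ | ⟨h, _ | ⟨j, m⟩⟩ <;> simp [rightTranslation, zero_mul']
    rcases a with _ | ⟨h, _ | ⟨j, m⟩⟩
    · simp [rightTranslation, mul_zero']
    · simp only [rightTranslation, triple_mul_triple]
      split_ifs <;> simp [mul_assoc]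
    · simp only [rightTranslation, triple_mul_triple]
      split_ifs <;> simp_all [mul_assoc, triple_mul_triple, mul_zero'] <;>
        split_ifs <;> tauto
  linked x y := by
    rcases x with _ | ⟨i, g, l⟩
    · rcases a with _ | ⟨h, _ | ⟨j, m⟩⟩ <;> simp [rightTranslation, zero_mul']
    rcases y with _ | ⟨i', g', l'⟩
    · rcases a with _ | ⟨h, _ | ⟨j, m⟩⟩ <;> simp [leftTranslation, mul_zero']
    rcases a with _ | ⟨h, _ | ⟨j, m⟩⟩
    · simp [leftTranslation, rightTranslation, mul_zero', zero_mul']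
    · simp [leftTranslation, rightTranslation, triple_mul_triple, mul_assoc]
    · simp only [leftTranslation, rightTranslation]
      split_ifs <;> simp_all [mul_assoc, triple_mul_triple, mul_zero', zero_mul'] <;>
        split_ifs <;> tauto

theorem toHull_mul (a b : HullElement G) : toHull (hullMul a b) = toHull a * toHull b := by
  apply TranslationalHull.ext
  · funext x
    change leftTranslation _ x = leftTranslation a (leftTranslation b x)
    rcases a with _ | ⟨h, _ | ⟨j, m⟩⟩ <;> rcases b with _ | ⟨h', _ | ⟨j', m'⟩⟩ <;>
      rcases x with _ | ⟨i, g, l⟩ <;> simp only [leftTranslation, hullMul, mul_assoc] <;>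
      split_ifs <;> simp_all [mul_assoc] <;> split_ifs <;> tauto
  · funext x
    change rightTranslation _ x = rightTranslation b (rightTranslation a x)
    rcases a with _ | ⟨h, _ | ⟨j, m⟩⟩ <;> rcases b with _ | ⟨h', _ | ⟨j', m'⟩⟩ <;>
      rcases x with _ | ⟨i, g, l⟩ <;> simp only [rightTranslation, hullMul, mul_assoc] <;>
      split_ifs <;> simp_all [mul_assoc] <;> split_ifs <;> tauto

/-- A few test triples suffice. At `[1, 1, 1]` only the zero element gives zero, and the group
component and the indices can be read off, except that a unit `g` acts there like `[1, g, 1]`; these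
two differ at `[0, 1, 1]`. -/
theorem toHull_injective : Function.Injective (toHull (G := G)) := by
  intro a b hab
  have hl : ∀ x, leftTranslation a x = leftTranslation b x := fun x =>
    congrFun (congrArg TranslationalHull.left hab) x
  have hr : ∀ x, rightTranslation a x = rightTranslation b x := fun x =>
    congrFun (congrArg TranslationalHull.right hab) x
  have l0 := hl (.triple 0 1 1)
  have l1 := hl (.triple 1 1 1)
  have r0 := hr (.triple 1 1 0)
  have r1 := hr (.triple 1 1 1)
  clear hl hr hab
  have fin2 : ∀ j : Fin 2, j = 0 ∨ j = 1 := by decide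
  rcases a with _ | ⟨h, _ | ⟨j, m⟩⟩ <;> rcases b with _ | ⟨h', _ | ⟨j', m'⟩⟩
  · rfl
  · simp [leftTranslation] at l1
  · simp [leftTranslation] at l1
  · simp [leftTranslation] at l1
  · simpa [leftTranslation] using l1
  · rcases fin2 j' with rfl | rfl <;> rcases fin2 m' with rfl | rfl <;>
      simp [leftTranslation] at l0 l1 r0 r1
  · simp [leftTranslation] at l1
  · rcases fin2 j with rfl | rfl <;> rcases fin2 m with rfl | rfl <;>
      simp [leftTranslation] at l0 l1 r0 r1
  · simp [leftTranslation] at l1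
    simp [rightTranslation] at r1
    simp [l1, r1]

/-- Since `[i, g, l] = [i, 1, 1] [1, g, l]`, a left translation is determined by its values at the
`[i, 1, 1]`, and dually on the right. These values are zero or of the form `[j, g, 1]`, and the four
linking equations leave only the normal forms. -/
theorem toHull_surjective : Function.Surjective (toHull (G := G)) := by
  intro ω
  have fin2 : ∀ j : Fin 2, j = 0 ∨ j = 1 := by decide
  have hl : ∀ i g l, ω.left (.triple i g l) = ω.left (.triple i 1 1) * .triple 1 g l := by
    intro i g l
    rw [← ω.left_mul, triple_mul_triple]
    simp
  have hr : ∀ i g l, ω.right (.triple i g l) = .triple i g 1 * ω.right (.triple 1 1 l) := by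
    intro i g l
    rw [← ω.right_mul, triple_mul_triple]
    simp
  have hl0 : ω.left .zero = .zero := by
    have := ω.left_mul .zero .zero
    rwa [zero_mul', mul_zero'] at this
  have hr0 : ω.right .zero = .zero := by
    have := ω.right_mul .zero .zero
    rwa [zero_mul', zero_mul'] at this
  have hlc : ∀ i, ω.left (.triple i 1 1) = .zero ∨ ∃ j g, ω.left (.triple i 1 1) = .triple j g 1 := by
    intro i
    have := hl i 1 1
    rcases h : ω.left (.triple i 1 1) with _ | ⟨j, g, l⟩
    · exact Or.inl rfl
    · rw [h, triple_mul_triple] at this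
      simp at this
      exact Or.inr ⟨j, g, by rw [this]⟩
  have hrc : ∀ l, ω.right (.triple 1 1 l) = .zero ∨
      ∃ g m, ω.right (.triple 1 1 l) = .triple 1 g m := by
    intro l
    have := hr 1 1 l
    rcases h : ω.right (.triple 1 1 l) with _ | ⟨j, g, m⟩
    · exact Or.inl rfl
    · rw [h, triple_mul_triple] at this
      simp at this
      exact Or.inr ⟨g, m, by rw [this]⟩
  have hlink : ∀ l i, (.triple 1 1 l * ω.left (.triple i 1 1) : Rees G) =
      ω.right (.triple 1 1 l) * .triple i 1 1 := fun l i => ω.linked _ _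
  suffices h : ∃ a : HullElement G, (∀ i, leftTranslation a (.triple i 1 1) = ω.left (.triple i 1 1)) ∧
      ∀ l, rightTranslation a (.triple 1 1 l) = ω.right (.triple 1 1 l) by
    obtain ⟨a, ha, ha'⟩ := h
    refine ⟨a, TranslationalHull.ext (funext fun x => ?_) (funext fun x => ?_)⟩
    · rcases x with _ | ⟨i, g, l⟩
      · rw [hl0]
        rcases a with _ | ⟨h, _ | ⟨j, m⟩⟩ <;> rfl
      · rw [hl, ← ha]
        rw [show ReesMatrixSemigroup.triple i g l =
          (ReesMatrixSemigroup.triple i 1 1 * ReesMatrixSemigroup.triple 1 g l : Rees G) by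
            rw [triple_mul_triple]; simp]
        exact (toHull a).left_mul _ _
    · rcases x with _ | ⟨i, g, l⟩
      · rw [hr0]
        rcases a with _ | ⟨h, _ | ⟨j, m⟩⟩ <;> rfl
      · rw [hr, ← ha']
        rw [show ReesMatrixSemigroup.triple i g l =
          (ReesMatrixSemigroup.triple i g 1 * ReesMatrixSemigroup.triple 1 1 l : Rees G) by
            rw [triple_mul_triple]; simp]
        exact (toHull a).right_mul _ _
  have e00 := hlink 0 0
  have e01 := hlink 0 1
  have e10 := hlink 1 0
  have e11 := hlink 1 1
  simp only [Fin.forall_fin_two]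
  rcases hlc 1 with h1 | ⟨j, g, h1⟩ <;> rcases hrc 1 with k1 | ⟨g', m, k1⟩ <;>
    rw [h1, k1] at e11 <;> simp only [triple_mul_triple, mul_zero', zero_mul'] at e11
  -- Row `1` and column `1` of the matrix contain no zero, so vanishing at index `1` forces
  -- vanishing at index `0` through the linking equations.
  · refine ⟨none, ?_⟩
    rcases hlc 0 with h0 | ⟨j', g', h0⟩ <;> rcases hrc 0 with k0 | ⟨g'', m', k0⟩ <;>
      simp_all [triple_mul_triple, mul_zero', zero_mul', leftTranslation, rightTranslation]
  · simp at e11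
  · simp at e11
  · simp at e11
    subst e11
    rcases fin2 j with rfl | rfl <;> rcases fin2 m with rfl | rfl
    · refine ⟨some (g, some (0, 0)), ?_⟩
      rcases hlc 0 with h0 | ⟨j', g', h0⟩ <;> rcases hrc 0 with k0 | ⟨g'', m', k0⟩ <;>
        simp_all [triple_mul_triple, mul_zero', zero_mul', leftTranslation, rightTranslation]
    · refine ⟨some (g, some (0, 1)), ?_⟩
      rcases hlc 0 with h0 | ⟨j', g', h0⟩ <;> rcases hrc 0 with k0 | ⟨g'', m', k0⟩ <;>
        simp_all [triple_mul_triple, mul_zero', zero_mul', leftTranslation, rightTranslation]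
    · refine ⟨some (g, some (1, 0)), ?_⟩
      rcases hlc 0 with h0 | ⟨j', g', h0⟩ <;> rcases hrc 0 with k0 | ⟨g'', m', k0⟩ <;>
        simp_all [triple_mul_triple, mul_zero', zero_mul', leftTranslation, rightTranslation]
    -- Here a unit and a triple `[1, g, 1]` agree at index `1`; the values at index `0` tell them
    -- apart.
    · rcases hlc 0 with h0 | ⟨j', g', h0⟩ <;> rcases hrc 0 with k0 | ⟨g'', m', k0⟩
      · simp_all [triple_mul_triple, mul_zero', zero_mul']
      · simp_all [triple_mul_triple, mul_zero', zero_mul']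
      · simp_all [triple_mul_triple, mul_zero', zero_mul']
      · rcases fin2 j' with rfl | rfl <;> rcases fin2 m' with rfl | rfl
        · refine ⟨some (g, none), ?_⟩
          simp_all [triple_mul_triple, leftTranslation, rightTranslation]
        · simp_all [triple_mul_triple]
        · simp_all [triple_mul_triple]
        · refine ⟨some (g, some (1, 1)), ?_⟩
          simp_all [triple_mul_triple, leftTranslation, rightTranslation]

end

end CornerZero

/-! ### Factors of words -/

/-- The word `L` has the factor `x w y`. -/
def HasFactor {α : Type*} (x : α) (w : List α) (y : α) (L : List α) : Prop :=
  ∃ a b, L = a ++ x :: (w ++ y :: b)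

/-- Every factor `x w y` of `L` is matched by a factor `x w' y` of `L'` such that all letters of
`w'` occur in `w`. -/
def FactorsCovered {α : Type*} (L L' : List α) : Prop :=
  ∀ x w y, HasFactor x w y L → ∃ w', HasFactor x w' y L' ∧ ∀ z ∈ w', z ∈ w

theorem HasFactor.reverse {α : Type*} {x y : α} {w L : List α} (h : HasFactor x w y L) :
    HasFactor y w.reverse x L.reverse := by
  obtain ⟨a, b, rfl⟩ := h
  exact ⟨b.reverse, a.reverse, by simp⟩

theorem FactorsCovered.reverse {α : Type*} {L L' : List α} (h : FactorsCovered L L') :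
    FactorsCovered L.reverse L'.reverse := by
  intro x w y hw
  obtain ⟨w', h1, h2⟩ := h y w.reverse x (by simpa using hw.reverse)
  exact ⟨w'.reverse, h1.reverse, by simpa using h2⟩

/-- Needed because the machine that checks coverage holds the words backwards on its stacks. -/
theorem factorsCovered_reverse_iff {α : Type*} {L L' : List α} :
    FactorsCovered L.reverse L'.reverse ↔ FactorsCovered L L' :=
  ⟨fun h => by simpa using h.reverse, FactorsCovered.reverse⟩

theorem hasFactor_map_iff {α β : Type*} {φ : α → β} {x y : β} {w : List β} {L : List α} :
    HasFactor x w y (L.map φ) ↔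
      ∃ x' w' y', HasFactor x' w' y' L ∧ φ x' = x ∧ w'.map φ = w ∧ φ y' = y := by
  constructor
  · rintro ⟨a, b, h⟩
    obtain ⟨a', c, rfl, rfl, h1⟩ := List.map_eq_append_iff.1 h
    obtain ⟨x', c, rfl, rfl, h2⟩ := List.map_eq_cons_iff.1 h1
    obtain ⟨w', c, rfl, rfl, h3⟩ := List.map_eq_append_iff.1 h2
    obtain ⟨y', c, rfl, rfl, h4⟩ := List.map_eq_cons_iff.1 h3
    exact ⟨x', w', y', ⟨a', c, rfl⟩, rfl, rfl, rfl⟩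
  · rintro ⟨x', w', y', ⟨a, b, rfl⟩, rfl, rfl, rfl⟩
    exact ⟨a.map φ, b.map φ, by simp⟩

theorem factorsCovered_map_iff {α β : Type*} {φ : α → β} (hφ : Function.Injective φ)
    {L L' : List α} : FactorsCovered (L.map φ) (L'.map φ) ↔ FactorsCovered L L' := by
  constructor
  · intro h x w y hw
    obtain ⟨w', h1, h2⟩ := h (φ x) (w.map φ) (φ y) (hasFactor_map_iff.2 ⟨x, w, y, hw, rfl, rfl, rfl⟩)
    obtain ⟨x', w'', y', h3, hx, rfl, hy⟩ := hasFactor_map_iff.1 h1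
    rw [hφ hx, hφ hy] at h3
    refine ⟨w'', h3, fun z hz => ?_⟩
    have := h2 (φ z) (List.mem_map_of_mem hz)
    rwa [List.mem_map_of_injective hφ] at this
  · intro h x w y hw
    obtain ⟨x', w', y', h1, rfl, rfl, rfl⟩ := hasFactor_map_iff.1 hw
    obtain ⟨w'', h2, h3⟩ := h _ _ _ h1
    refine ⟨w''.map φ, hasFactor_map_iff.2 ⟨_, _, _, h2, rfl, rfl, rfl⟩, ?_⟩
    simp only [List.mem_map]
    rintro _ ⟨z, hz, rfl⟩
    exact ⟨z, h3 z hz, rfl⟩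

/-- It suffices to consider factors `x w y` in which `x` and `y` do not occur in `w`. -/
theorem factorsCovered_of_notMem {α : Type*} {L L' : List α}
    (h : ∀ x w y, HasFactor x w y L → x ∉ w → y ∉ w →
      ∃ w', HasFactor x w' y L' ∧ ∀ z ∈ w', z ∈ w) : FactorsCovered L L' := by
  intro x w y hw
  induction hn : w.length using Nat.strong_induction_on generalizing w with
  | _ n ih =>
    by_cases hx : x ∈ w
    -- Start the factor at the later occurrence of `x`: the middle gets shorter and keeps only
    -- letters of `w`.
    · obtain ⟨s, t, rfl⟩ := List.append_of_mem hx
      obtain ⟨a, b, rfl⟩ := hw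
      obtain ⟨w', h1, h2⟩ := ih t.length (by simp at hn; omega) t
        ⟨a ++ x :: s, b, by simp⟩ rfl
      exact ⟨w', h1, fun z hz => by simp [h2 z hz]⟩
    · by_cases hy : y ∈ w
      · obtain ⟨s, t, rfl⟩ := List.append_of_mem hy
        obtain ⟨a, b, rfl⟩ := hw
        obtain ⟨w', h1, h2⟩ := ih s.length (by simp at hn; omega) s
          ⟨a, t ++ y :: b, by simp⟩ rfl
        exact ⟨w', h1, fun z hz => by simp [h2 z hz]⟩
      · exact h x w y hw hx hy

/-- A word enclosed in two end markers. -/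
def framed (u : List ℕ) : List (Option ℕ) := none :: (u.map some ++ [none])

/-- The middle of a factor lies strictly inside the word, and the markers occupy only its two ends.
-/
theorem HasFactor.none_notMem_framed {x y : Option ℕ} {w : List (Option ℕ)} {u : List ℕ}
    (h : HasFactor x w y (framed u)) : none ∉ w := by
  obtain ⟨a, b, h⟩ := h
  intro hw
  have key : none ∈ u.map some := by
    rcases a with _ | ⟨c, a⟩
    · have h' := congrArg List.dropLast (List.cons.inj h).2
      rw [List.dropLast_concat, List.dropLast_append_of_ne_nil (by simp)] at h'
      rw [h']
      simp [hw]
    · have h' := congrArg List.dropLast (List.cons.inj h).2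
      rw [List.dropLast_concat, List.append_eq, List.dropLast_append_of_ne_nil (by simp),
        List.dropLast_cons_of_ne_nil (by simp), List.dropLast_append_of_ne_nil (by simp)] at h'
      rw [h']
      simp [hw]
  simp at key

namespace CornerZero

section

variable {G : Type u} [Group G]

/-! ### Evaluation of words in the translational hull -/

theorem hullMul_assoc (a b c : HullElement G) :
    hullMul (hullMul a b) c = hullMul a (hullMul b c) :=
  toHull_injective (by simp only [toHull_mul, mul_assoc])

/-- The identity element. -/
abbrev hullOne : HullElement G := some (1, none)

theorem hullOne_mul (a : HullElement G) : hullMul hullOne a = a := by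
  rcases a with _ | ⟨h, _ | ⟨j, m⟩⟩ <;> simp [hullMul]

theorem hullMul_one (a : HullElement G) : hullMul a hullOne = a := by
  rcases a with _ | ⟨h, _ | ⟨j, m⟩⟩ <;> simp [hullMul]

theorem hullMul_none (a : HullElement G) : hullMul a none = none := by
  rcases a with _ | ⟨h, _ | ⟨j, m⟩⟩ <;> simp [hullMul]

theorem none_hullMul (a : HullElement G) : hullMul none a = none := by
  simp [hullMul]

/-- The value of a word. -/
def evalWord {α : Type*} (h : α → HullElement G) : List α → HullElement G
  | [] => hullOne
  | z :: L => hullMul (h z) (evalWord h L)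

theorem evalWord_append {α : Type*} (h : α → HullElement G) (L L' : List α) :
    evalWord h (L ++ L') = hullMul (evalWord h L) (evalWord h L') := by
  induction L with
  | nil => exact (hullOne_mul _).symm
  | cons z L ih => simp [evalWord, ih, hullMul_assoc]

theorem evalWord_map {α β : Type*} (φ : β → α) (h : α → HullElement G) (L : List β) :
    evalWord h (L.map φ) = evalWord (h ∘ φ) L := by
  induction L with
  | nil => rfl
  | cons z L ih => simp [evalWord, ih]

theorem evalWord_unit {α : Type*} (g : α → G) (L : List α) :
    evalWord (fun z => some (g z, none)) L = some ((L.map g).prod, none) := by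
  induction L with
  | nil => rfl
  | cons z L ih => simp [evalWord, ih, hullMul]

/-- The group component of a normal form (and `1` for the zero element). -/
def groupPart (a : HullElement G) : G := a.elim 1 Prod.fst

/-- No matrix entry contributes to the group component, so it does not matter which letters are
units and which are triples. -/
theorem groupPart_evalWord {α : Type*} (h : α → HullElement G) (L : List α) (g : G)
    (t : Option (Fin 2 × Fin 2)) (he : evalWord h L = some (g, t)) :
    g = (L.map fun z => groupPart (h z)).prod := by
  induction L generalizing g t with
  | nil =>
    simp only [evalWord, hullOne, Option.some.injEq, Prod.mk.injEq] at he
    simp [he.1]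
  | cons z L ih =>
    rw [evalWord] at he
    rw [List.map_cons, List.prod_cons]
    rcases h1 : evalWord h L with _ | ⟨g', t'⟩
    · rw [h1, hullMul_none] at he
      simp at he
    · rw [h1] at he
      rw [← ih _ _ h1]
      rcases h2 : h z with _ | ⟨g'', _ | ⟨i, l⟩⟩
      · simp [h2, hullMul] at he
      · simp [h2, hullMul] at he
        simp [groupPart, he.1]
      · rcases t' with _ | ⟨j, m⟩
        · simp [h2, hullMul] at he
          simp [groupPart, he.1]
        · simp [h2, hullMul] at he
          simp [groupPart, he.2.1]

/-- The letter is evaluated to a unit. -/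
def IsUnitValue (a : HullElement G) : Prop := ∃ g, a = some (g, none)

theorem isUnitValue_evalWord {α : Type*} (h : α → HullElement G) (L : List α)
    (hL : ∀ z ∈ L, IsUnitValue (h z)) : IsUnitValue (evalWord h L) := by
  induction L with
  | nil => exact ⟨1, rfl⟩
  | cons z L ih =>
    obtain ⟨g, hg⟩ := hL z (by simp)
    obtain ⟨g', hg'⟩ := ih fun z hz => hL z (by simp [hz])
    exact ⟨g * g', by simp [evalWord, hg, hg', hullMul]⟩

/-- Units to the left of a triple change only its group component, so the first index of a product
comes from its first letter that is not a unit. -/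
theorem first_of_evalWord {α : Type*} {h : α → HullElement G} {L : List α} {g : G} {i l : Fin 2}
    (he : evalWord h L = some (g, some (i, l))) :
    ∃ w y b, L = w ++ y :: b ∧ (∀ z ∈ w, IsUnitValue (h z)) ∧ ∃ g' m, h y = some (g', some (i, m)) := by
  induction L generalizing g l with
  | nil => simp [evalWord] at he
  | cons z L ih =>
    rw [evalWord] at he
    rcases h2 : h z with _ | ⟨g'', _ | ⟨i', l'⟩⟩
    · rw [h2] at he
      simp [hullMul] at he
    · rcases h1 : evalWord h L with _ | ⟨g', _ | ⟨j, m⟩⟩ <;> rw [h1, h2] at he <;>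
        simp [hullMul] at he
      obtain ⟨-, rfl, rfl⟩ := he
      obtain ⟨w, y, b, rfl, hw, hy⟩ := ih h1
      refine ⟨z :: w, y, b, rfl, ?_, hy⟩
      intro x hx
      rcases List.mem_cons.1 hx with rfl | hx
      · exact ⟨_, h2⟩
      · exact hw x hx
    · refine ⟨[], z, L, rfl, by simp, g'', l', ?_⟩
      rcases h1 : evalWord h L with _ | ⟨g', _ | ⟨j, m⟩⟩ <;> rw [h1, h2] at he <;>
        simp [hullMul] at he
      · rw [h2, he.2.1]
      · rw [h2, he.2.2.1]

/-- The factor `x w y` makes a product vanish. -/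
def IsZeroFactor {α : Type*} (h : α → HullElement G) (x : α) (w : List α) (y : α) : Prop :=
  (∃ g i, h x = some (g, some (i, 0))) ∧ (∀ z ∈ w, IsUnitValue (h z)) ∧
    ∃ g m, h y = some (g, some (0, m))

/-- A nonzero letter annihilates a nonzero tail only if index `0` meets index `0`. By
`first_of_evalWord` the first index of the tail is carried by its first non-unit letter, so only
units stand between the two letters responsible. -/
theorem evalWord_eq_none_iff {α : Type*} (h : α → HullElement G) (L : List α) :
    evalWord h L = none ↔
      (∃ z ∈ L, h z = none) ∨ ∃ x w y, HasFactor x w y L ∧ IsZeroFactor h x w y := by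
  constructor
  · intro he
    induction L with
    | nil => simp [evalWord] at he
    | cons z L ih =>
      by_cases h1 : evalWord h L = none
      · rcases ih h1 with ⟨z, hz, hz'⟩ | ⟨x, w, y, ⟨a, b, rfl⟩, hf⟩
        · exact Or.inl ⟨z, by simp [hz], hz'⟩
        · exact Or.inr ⟨x, w, y, ⟨z :: a, b, rfl⟩, hf⟩
      · rw [evalWord] at he
        rcases h2 : h z with _ | ⟨g'', _ | ⟨i, l⟩⟩
        · exact Or.inl ⟨z, by simp, h2⟩
        · rcases h3 : evalWord h L with _ | ⟨g', t⟩
          · exact absurd h3 h1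
          · simp [h2, h3, hullMul] at he
        · rcases h3 : evalWord h L with _ | ⟨g', _ | ⟨j, m⟩⟩
          · exact absurd h3 h1
          · simp [h2, h3, hullMul] at he
          · simp [h2, h3, hullMul] at he
            obtain ⟨rfl, rfl⟩ := he
            obtain ⟨w, y, b, rfl, hw, hy⟩ := first_of_evalWord h3
            exact Or.inr ⟨z, w, y, ⟨[], b, rfl⟩, ⟨_, _, h2⟩, hw, hy⟩
  · rintro (⟨z, hz, hz'⟩ | ⟨x, w, y, ⟨a, b, rfl⟩, ⟨g, i, hx⟩, hw, g', m, hy⟩)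
    · obtain ⟨s, t, rfl⟩ := List.append_of_mem hz
      rw [evalWord_append, evalWord, hz', none_hullMul, hullMul_none]
    · obtain ⟨g'', hg⟩ := isUnitValue_evalWord h w hw
      rw [evalWord_append, evalWord, evalWord_append, evalWord, hx, hy, hg]
      suffices hin : hullMul (some (g, some (i, 0))) (hullMul (some (g'', none))
          (hullMul (some (g', some (0, m))) (evalWord h b))) = none by
        rw [hin, hullMul_none]
      rcases evalWord h b with _ | ⟨k, _ | ⟨j', m'⟩⟩
      · rfl
      · simp [hullMul]
      · simp only [hullMul]
        split_ifs <;> simp [hullMul]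

/-- An assignment to the letters, extended to the end marker. -/
def extend (h : ℕ → HullElement G) (i l : Fin 2) : Option ℕ → HullElement G
  | some n => h n
  | none => some (1, some (i, l))

theorem evalWord_framed (h : ℕ → HullElement G) (i l : Fin 2) (u : List ℕ) :
    evalWord (extend h i l) (framed u) =
      hullMul (some (1, some (i, l))) (hullMul (evalWord h u) (some (1, some (i, l)))) := by
  rw [framed, evalWord, evalWord_append, evalWord_map]
  change hullMul _ (hullMul (evalWord h u) (hullMul _ hullOne)) = _
  rw [hullMul_one]
  rfl

/-- Between two copies of `[i, 1, l]`, zero always vanishes, a unit vanishes only for `i = l = 0`,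
and `[j, g, m]` vanishes exactly if `l = j = 0` or `m = i = 0`. These six patterns are distinct, so
one common value for both end markers is enough to recover everything but the group component. -/
theorem eq_of_sandwich {a b : HullElement G}
    (hab : ∀ i l, hullMul (some (1, some (i, l))) (hullMul a (some (1, some (i, l)))) = none ↔
      hullMul (some (1, some (i, l))) (hullMul b (some (1, some (i, l)))) = none)
    (hg : ∀ g t g' t', a = some (g, t) → b = some (g', t') → g = g') : a = b := by
  have h00 := hab 0 0
  have h01 := hab 0 1
  have h10 := hab 1 0
  have h11 := hab 1 1
  have fin2 : ∀ j : Fin 2, j = 0 ∨ j = 1 := by decide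
  rcases a with _ | ⟨g, _ | ⟨i, l⟩⟩ <;> rcases b with _ | ⟨g', _ | ⟨j, m⟩⟩
  · rfl
  · simp [hullMul] at h11
  · rcases fin2 j with rfl | rfl <;> rcases fin2 m with rfl | rfl <;> simp [hullMul] at h11
  · simp [hullMul] at h11
  · rw [hg _ _ _ _ rfl rfl]
  · rcases fin2 j with rfl | rfl <;> rcases fin2 m with rfl | rfl <;>
      simp [hullMul] at h00 h01 h10 h11
  · rcases fin2 i with rfl | rfl <;> rcases fin2 l with rfl | rfl <;> simp [hullMul] at h11
  · rcases fin2 i with rfl | rfl <;> rcases fin2 l with rfl | rfl <;>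
      simp [hullMul] at h00 h01 h10 h11
  · rw [hg _ _ _ _ rfl rfl]
    rcases fin2 j with rfl | rfl <;> rcases fin2 m with rfl | rfl <;>
      rcases fin2 i with rfl | rfl <;> rcases fin2 l with rfl | rfl <;>
      simp [hullMul] at h00 h01 h10 h11 ⊢

/-- The leaves of a semigroup term. -/
def _root_.SemigroupTerm.leaves : SemigroupTerm → List ℕ
  | .var n => [n]
  | .mul p q => p.leaves ++ q.leaves

theorem eval_toHull (h : ℕ → HullElement G) (p : SemigroupTerm) :
    p.eval (fun n => toHull (h n)) = toHull (evalWord h p.leaves) := by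
  induction p with
  | var n => simp [SemigroupTerm.eval, SemigroupTerm.leaves, evalWord, hullMul_one]
  | mul p q hp hq =>
    rw [SemigroupTerm.eval, SemigroupTerm.leaves, evalWord_append, toHull_mul, hp, hq]

theorem forall_eval_eq_iff (p q : SemigroupTerm) :
    (∀ e : ℕ → TranslationalHull (Rees G), p.eval e = q.eval e) ↔
      ∀ h : ℕ → HullElement G, evalWord h p.leaves = evalWord h q.leaves := by
  constructor
  · intro H h
    have := H fun n => toHull (h n)
    rwa [eval_toHull, eval_toHull, toHull_injective.eq_iff] at this
  · intro H e
    choose h hh using fun n => toHull_surjective (e n)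
    obtain rfl : (fun n => toHull (h n)) = e := funext hh
    rw [eval_toHull, eval_toHull, H]

/-- For a factor `x w y` with `x` and `y` outside `w`, send the letters of `w` to the identity and
all others to triples, with first index `0` only at `y` and second index `0` only at `x`. The framed
`u` vanishes, hence so does the framed `v`, and a factor responsible for that can only run from `x`
to `y` through letters of `w`. -/
theorem factorsCovered_of_evalWord {u v : List ℕ}
    (H : ∀ h : ℕ → HullElement G, evalWord h u = evalWord h v) :
    FactorsCovered (framed u) (framed v) := by
  classical
  apply factorsCovered_of_notMem
  intro x w y hw hx hy
  let h : Option ℕ → HullElement G := fun z =>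
    if z ∈ w then some (1, none) else some (1, some (if z = y then 0 else 1, if z = x then 0 else 1))
  -- The marker must receive a triple, not a unit, for the assignment to be of the form `extend`.
  have hn : none ∉ w := hw.none_notMem_framed
  have hh : h = extend (fun n => h (some n)) (if none = y then 0 else 1)
      (if none = x then 0 else 1) := by
    funext z
    rcases z with _ | n
    · simp [h, hn, extend]
    · rfl
  have hz : evalWord h (framed u) = none := by
    refine (evalWord_eq_none_iff h _).2 (Or.inr ⟨x, w, y, hw, ?_, ?_, ?_⟩)
    · exact ⟨1, _, by simp [h, hx]; rfl⟩
    · intro z hz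
      exact ⟨1, by simp [h, hz]⟩
    · exact ⟨1, _, by simp [h, hy]; rfl⟩
  have hz' : evalWord h (framed v) = none := by
    rw [hh, evalWord_framed] at hz ⊢
    rwa [← H]
  rcases (evalWord_eq_none_iff h _).1 hz' with ⟨z, -, hz⟩ | ⟨x', w', y', h1, h2, h3, h4⟩
  · simp only [h] at hz
    split_ifs at hz
  · have hxx : x' = x := by
      obtain ⟨g, i, h2⟩ := h2
      by_contra hne
      simp only [h, if_neg hne] at h2
      split_ifs at h2 <;> simp at h2
    have hyy : y' = y := by
      obtain ⟨g, i, h4⟩ := h4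
      by_contra hne
      simp only [h, if_neg hne] at h4
      split_ifs at h4 <;> simp at h4
    subst hxx hyy
    refine ⟨w', h1, fun z hz => ?_⟩
    obtain ⟨g, hg⟩ := h3 z hz
    by_contra hne
    simp [h, hne] at hg

/-- If a letter of `u` is sent to zero, covering the factor from the left marker to that letter
shows that it occurs in `v`. Otherwise a zero factor is covered by one whose inner letters are among
the same units. -/
theorem evalWord_framed_eq_none {u v : List ℕ} (hC : FactorsCovered (framed u) (framed v))
    (h : ℕ → HullElement G) (i l : Fin 2) (hu : evalWord (extend h i l) (framed u) = none) :
    evalWord (extend h i l) (framed v) = none := by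
  rw [evalWord_eq_none_iff] at hu ⊢
  rcases hu with ⟨z, hz, hz'⟩ | ⟨x, w, y, h1, h2, h3, h4⟩
  · rcases z with _ | n
    · simp [extend] at hz'
    · have hn : some n ∈ u.map some := by
        simpa [framed] using hz
      obtain ⟨s, t, hs⟩ := List.append_of_mem hn
      obtain ⟨w', ⟨a, b, e⟩, -⟩ := hC none s (some n) ⟨[], t ++ [none], by simp [framed, hs]⟩
      exact Or.inl ⟨some n, by simp [e], hz'⟩
  · obtain ⟨w', h5, h6⟩ := hC x w y h1
    exact Or.inr ⟨x, w', y, h5, h2, fun z hz => h3 z (h6 z hz), h4⟩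

/-- The equational theory of the translational hull of `𝓜(G; M)`. -/
theorem forall_eval_eq_iff_factorsCovered (p q : SemigroupTerm) :
    (∀ e : ℕ → TranslationalHull (Rees G), p.eval e = q.eval e) ↔
      (∀ g : ℕ → G, (p.leaves.map g).prod = (q.leaves.map g).prod) ∧
        FactorsCovered (framed p.leaves) (framed q.leaves) ∧
        FactorsCovered (framed q.leaves) (framed p.leaves) := by
  rw [forall_eval_eq_iff]
  constructor
  · intro H
    refine ⟨fun g => ?_, factorsCovered_of_evalWord H, factorsCovered_of_evalWord fun h => (H h).symm⟩
    simpa [evalWord_unit] using H fun n => some (g n, none)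
  · rintro ⟨hg, h1, h2⟩ h
    apply eq_of_sandwich
    · intro i l
      rw [← evalWord_framed, ← evalWord_framed]
      exact ⟨evalWord_framed_eq_none h1 h i l, evalWord_framed_eq_none h2 h i l⟩
    · intro g t g' t' e1 e2
      rw [groupPart_evalWord h _ _ _ e1, groupPart_evalWord h _ _ _ e2, hg]

/-! ### From group terms to semigroup terms -/

/-- The word, in signed letters, of a group term. -/
def _root_.GroupTerm.signedWord : GroupTerm → List (Bool × ℕ)
  | .var n => [(true, n)]
  | .one => []
  | .inv p => (p.signedWord.map fun a => (!a.1, a.2)).reverse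
  | .mul p q => p.signedWord ++ q.signedWord

/-- The word in which every positive letter occurs once and every negative letter is replaced by
its `m`-th power. -/
def expand (m : ℕ) (w : List (Bool × ℕ)) : List ℕ :=
  w.flatMap fun a => List.replicate (if a.1 then 1 else m) a.2

/-- A semigroup term whose leaves are a given word and `x_0`. -/
def comb (w : List ℕ) : SemigroupTerm :=
  w.foldr (fun n p => .mul (.var n) p) (.var 0)

theorem leaves_comb (w : List ℕ) : (comb w).leaves = w ++ [0] := by
  induction w with
  | nil => rfl
  | cons n w ih => exact congrArg (n :: ·) ih

theorem prod_expand {m : ℕ} (hm : ∀ g : G, g ^ m = g⁻¹) (g : ℕ → G) (w : List (Bool × ℕ)) :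
    ((expand m w).map g).prod = (w.map fun a => if a.1 then g a.2 else (g a.2)⁻¹).prod := by
  induction w with
  | nil => rfl
  | cons a w ih =>
    rw [expand, List.flatMap_cons, ← expand, List.map_append, List.prod_append, ih, List.map_cons,
      List.prod_cons, List.map_replicate, List.prod_replicate]
    rcases a with ⟨_ | _, n⟩ <;> simp [hm]

theorem prod_signedWord (g : ℕ → G) (p : GroupTerm) :
    (p.signedWord.map fun a => if a.1 then g a.2 else (g a.2)⁻¹).prod = p.eval g := by
  induction p with
  | var n => simp [GroupTerm.signedWord, GroupTerm.eval]
  | one => simp [GroupTerm.signedWord, GroupTerm.eval]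
  | inv p ih =>
    rw [GroupTerm.signedWord, GroupTerm.eval, ← ih, List.prod_inv_reverse, List.map_reverse,
      List.map_map, List.map_map]
    congr 2
    refine List.map_congr_left fun a _ => ?_
    rcases a with ⟨_ | _, n⟩ <;> simp
  | mul p q hp hq => simp [GroupTerm.signedWord, GroupTerm.eval, hp, hq]

/-- The signed word of `s * t⁻¹`. -/
def quotientWord (s t : GroupTerm) : List (Bool × ℕ) := (GroupTerm.mul s (.inv t)).signedWord

/-- The pair of semigroup terms `(w ^ 3 * x_0, w ^ 2 * x_0)`, where `w` is a word for `s * t⁻¹`. -/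
def powerPair (m : ℕ) (st : GroupTerm × GroupTerm) : SemigroupTerm × SemigroupTerm :=
  (comb (expand m (quotientWord st.1 st.2) ++ expand m (quotientWord st.1 st.2) ++
      expand m (quotientWord st.1 st.2)),
    comb (expand m (quotientWord st.1 st.2) ++ expand m (quotientWord st.1 st.2)))

/-- If `w` is trivial on `G`, its value in the hull is zero, the identity, or some `[i, 1, l]`,
which is idempotent or has square zero; in each case square and cube agree. Evaluation at units and
cancellation give the converse. The final `x_0` provides a term even if `w` is empty. -/
theorem powerPair_correct {m : ℕ} (hm : ∀ g : G, g ^ m = g⁻¹) (st : GroupTerm × GroupTerm) :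
    (∀ g : ℕ → G, st.1.eval g = st.2.eval g) ↔
      ∀ e : ℕ → TranslationalHull (Rees G),
        (powerPair m st).1.eval e = (powerPair m st).2.eval e := by
  have hprod : ∀ g : ℕ → G, ((expand m (quotientWord st.1 st.2)).map g).prod =
      st.1.eval g * (st.2.eval g)⁻¹ := by
    intro g
    rw [prod_expand hm, quotientWord, prod_signedWord]
    rfl
  rw [forall_eval_eq_iff]
  simp only [powerPair, leaves_comb, evalWord_append]
  generalize expand m (quotientWord st.1 st.2) = w at *
  constructor
  · intro H h
    have h1 : ∀ g : ℕ → G, (w.map g).prod = 1 := by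
      intro g
      rw [hprod, H, mul_inv_cancel]
    congr 1
    rcases he : evalWord h w with _ | ⟨g, t⟩
    · simp [hullMul]
    · obtain rfl : g = 1 := by
        rw [groupPart_evalWord h _ _ _ he]
        exact h1 _
      rcases t with _ | ⟨i, l⟩
      · simp [hullMul]
      · by_cases hil : l = 0 ∧ i = 0 <;> simp [hullMul, hil]
  · intro H g
    have := H fun n => some (g n, none)
    simp only [evalWord_unit, hprod] at this
    simp only [hullMul, Option.some.injEq, Prod.mk.injEq, and_true, mul_left_inj] at this
    rw [mul_eq_left] at this
    exact mul_inv_eq_one.1 this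

end

end CornerZero

instance : Fintype TermSymbol where
  elems := Finset.mk (([.mul, .inv, .one, .var, .bit true, .bit false, .sep] : List TermSymbol) : Multiset _)
    (by simp)
  complete x := by rcases x with _ | _ | _ | _ | ⟨_ | _⟩ | _ <;> simp

instance : Inhabited TermSymbol := ⟨.sep⟩

/-! ### A machine rewriting group terms -/

namespace GroupTermMachine

open StackProgram CornerZero

/-- The symbols on the work stacks: input symbols, delimiters of signed letters, and the symbol
which ends a word. -/
inductive Cell : Type
  | sym (c : TermSymbol)
  | sgn (s : Bool)
  | sep
  deriving Fintype

instance : Inhabited Cell := ⟨.sep⟩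

/-- The work stacks. -/
inductive Stk : Type
  | tok
  | val
  | tmp
  | buf
  | aux
  deriving DecidableEq

instance : Fintype Stk where
  elems := {.tok, .val, .tmp, .buf, .aux}
  complete x := by cases x <;> simp

/-- The contents of the work stacks. -/
def stk (r z t y y' : List Cell) : Stk → List Cell
  | .tok => r
  | .val => z
  | .tmp => t
  | .buf => y
  | .aux => y'

section

variable (r z t y y' x : List Cell)

@[simp] theorem stk_tok : stk r z t y y' .tok = r := rfl
@[simp] theorem stk_val : stk r z t y y' .val = z := rfl
@[simp] theorem stk_tmp : stk r z t y y' .tmp = t := rfl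
@[simp] theorem stk_buf : stk r z t y y' .buf = y := rfl
@[simp] theorem stk_aux : stk r z t y y' .aux = y' := rfl

@[simp] theorem update_tok : Function.update (stk r z t y y') .tok x = stk x z t y y' := by
  funext k; cases k <;> rfl

@[simp] theorem update_val : Function.update (stk r z t y y') .val x = stk r x t y y' := by
  funext k; cases k <;> rfl

@[simp] theorem update_tmp : Function.update (stk r z t y y') .tmp x = stk r z x y y' := by
  funext k; cases k <;> rfl

@[simp] theorem update_buf : Function.update (stk r z t y y') .buf x = stk r z t x y' := by
  funext k; cases k <;> rfl

@[simp] theorem update_aux : Function.update (stk r z t y y') .aux x = stk r z t y x := by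
  funext k; cases k <;> rfl

theorem stk_nil : stk [] [] [] [] [] = fun _ => [] := by
  funext k; cases k <;> rfl

end

/-- The finite state: a register, and whether the machine is inside the string of a letter. -/
abbrev St : Type := Option Cell × Bool

/-- Programs of the machine. -/
abbrev Program : Type := Prog St TermSymbol TermSymbol Stk Cell

/-- Stores of the machine. -/
abbrev Sto : Type := Store TermSymbol TermSymbol Stk Cell

/-- The end of a word. -/
def isSep : Cell → Bool
  | .sep => true
  | _ => false

/-- Replace the delimiters of a letter by those of the inverse letter. -/
def flipCell : Cell → Cell
  | .sgn s => .sgn !s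
  | c => c

/-- The bits of a variable. -/
def bits (n : ℕ) : List TermSymbol := (Computability.encodeNat n).map .bit

/-- The string of a signed letter. The bits of negative letters are written backwards. -/
def letterString (a : Bool × ℕ) : List Cell :=
  .sgn a.1 :: ((if a.1 then bits a.2 else (bits a.2).reverse).map .sym ++ [.sgn a.1])

/-- The string of a word in signed letters. -/
def wordString (w : List (Bool × ℕ)) : List Cell := w.flatMap letterString

theorem wordString_append (w w' : List (Bool × ℕ)) :
    wordString (w ++ w') = wordString w ++ wordString w' := by
  simp [wordString]

theorem isSep_of_mem_wordString {w : List (Bool × ℕ)} {c : Cell} (hc : c ∈ wordString w) :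
    isSep c = false := by
  obtain ⟨a, -, ha⟩ := List.mem_flatMap.1 hc
  simp only [letterString, List.mem_cons, List.mem_append, List.mem_map, List.not_mem_nil,
    or_false] at ha
  rcases ha with rfl | ⟨x, -, rfl⟩ | rfl <;> rfl

/-- This is what the delimiters at both ends and the backward bits of negative letters are for:
inverting a word amounts to reversing its string and flipping the signs. -/
theorem reverse_flip_letterString (a : Bool × ℕ) :
    ((letterString a).map flipCell).reverse = letterString (!a.1, a.2) := by
  rcases a with ⟨_ | _, n⟩ <;>
    simp [letterString, flipCell, Function.comp_def, ← List.map_reverse]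

theorem reverse_flip_wordString (w : List (Bool × ℕ)) :
    ((wordString w).map flipCell).reverse =
      wordString ((w.map fun a => (!a.1, a.2)).reverse) := by
  induction w with
  | nil => rfl
  | cons a w ih =>
    rw [List.map_cons, List.reverse_cons, wordString_append, ← ih]
    simp [wordString, ← reverse_flip_letterString]

theorem length_bits (n : ℕ) : (encodeVar n).length = (bits n).length + 1 := by
  simp [encodeVar, bits]

/-- A letter has two delimiters against the single symbol `var`, whence the factor `2`; inversion
preserves the length of the string. -/
theorem length_wordString_signedWord (p : GroupTerm) :
    (wordString p.signedWord).length ≤ 2 * p.encode.length := by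
  induction p with
  | var n =>
    simp [GroupTerm.signedWord, wordString, letterString, GroupTerm.encode, length_bits]
  | one => simp [GroupTerm.signedWord, wordString]
  | inv p ih =>
    rw [GroupTerm.signedWord, ← reverse_flip_wordString]
    simp [GroupTerm.encode]
    omega
  | mul p q hp hq =>
    rw [GroupTerm.signedWord, wordString_append]
    simp [GroupTerm.encode]
    omega

/-! #### Reading the input -/

/-- Read an input symbol into the register. -/
@[simp]
def readReg (v : St) (o : Option TermSymbol) : St := (o.map .sym, v.2)

/-- The symbol in the register. -/
@[simp]
def reg (v : St) : Cell := v.1.getD .sep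

/-- Move the input to the stack of tokens. -/
def readInput : Program :=
  .seq (.blk (.read readReg .done))
    (.loop (fun v => v.1.isSome) (.blk (.push .tok reg (.read readReg .done))))

theorem exec_readInput (i o : List TermSymbol) (b : Bool) (v : Option Cell) :
    Exec readInput (v, b) ⟨i, o, stk [] [] [] [] []⟩ (none, b)
      ⟨[], o, stk (i.reverse.map .sym) [] [] [] []⟩ (2 * i.length + 2) := by
  have key : ∀ (i : List TermSymbol) (r : List Cell),
      Exec (.loop (fun v => v.1.isSome) (.blk (.push .tok reg (.read readReg .done))) : Program)
        (i.head?.map .sym, b) ⟨i.tail, o, stk r [] [] [] []⟩ (none, b)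
        ⟨[], o, stk (i.reverse.map .sym ++ r) [] [] [] []⟩ (2 * i.length + 1) := by
    intro i
    induction i with
    | nil => exact fun r => Exec.loop_false rfl
    | cons c i ih =>
      intro r
      refine (Exec.loop_true rfl (Exec.block ?_) (ih (.sym c :: r))).congr rfl ?_ ?_
      · simp
      · simp
      · simp
        omega
  refine (Exec.seq (Exec.block rfl) (key i [])).congr rfl (by simp) (by omega)

/-! #### Evaluating the terms -/

/-- Replace the top word by its inverse. -/
def invTop : Program :=
  .seq (transfer .val .tmp isSep flipCell)
    (.seq (.blk (.push .val (fun _ => .sep) .done)) (.seq (move .tmp .buf) (move .buf .val)))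

/-- Three transfers reverse the word three times, hence once in effect. The first also flips the
signs and consumes the separator, which is then put back. -/
theorem exec_invTop (s r z : List Cell) (hs : ∀ c ∈ s, isSep c = false) (v : St)
    (i o : List TermSymbol) :
    Exec invTop v ⟨i, o, stk r (s ++ .sep :: z) [] [] []⟩ (none, v.2)
      ⟨i, o, stk r ((s.map flipCell).reverse ++ .sep :: z) [] [] []⟩ (6 * s.length + 7) := by
  have h1 := exec_transfer (ι := TermSymbol) (ω := TermSymbol) (F := Bool) (g := flipCell)
    (show Stk.val ≠ Stk.tmp by decide) s (.sep :: z) hs (by simp [isSep]) v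
    ⟨i, o, stk r (s ++ .sep :: z) [] [] []⟩ rfl
  simp only [List.tail_cons, update_val, update_tmp, stk_tmp, List.append_nil] at h1
  refine (Exec.seq h1 (Exec.seq (Exec.block rfl)
    (Exec.seq (exec_move (by decide) _ _) (exec_move (by decide) _ _)))).congr rfl (by simp) ?_
  simp
  omega

/-- Concatenate the two top words. -/
def concatTop : Program :=
  .seq (transfer .val .tmp isSep id) (move .tmp .val)

theorem exec_concatTop (s r z : List Cell) (hs : ∀ c ∈ s, isSep c = false) (v : St)
    (i o : List TermSymbol) :
    Exec concatTop v ⟨i, o, stk r (s ++ .sep :: z) [] [] []⟩ (none, v.2)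
      ⟨i, o, stk r (s ++ z) [] [] []⟩ (4 * s.length + 4) := by
  have h1 := exec_transfer (ι := TermSymbol) (ω := TermSymbol) (F := Bool) (g := id)
    (show Stk.val ≠ Stk.tmp by decide) s (.sep :: z) hs (by simp [isSep]) v
    ⟨i, o, stk r (s ++ .sep :: z) [] [] []⟩ rfl
  simp only [List.tail_cons, update_val, update_tmp, stk_tmp, List.append_nil, List.map_id] at h1
  refine (Exec.seq h1 (exec_move (by decide) _ _)).congr rfl (by simp) ?_
  simp
  omega

/-- The token in the register asks for an inversion. -/
def isInv : Option Cell → Bool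
  | some (.sym .inv) => true
  | some (.sym .sep) => true
  | _ => false

/-- The token in the register is a given symbol. -/
def isMul : Option Cell → Bool
  | some (.sym .mul) => true
  | _ => false

/-- The token in the register is the constant. -/
def isOne : Option Cell → Bool
  | some (.sym .one) => true
  | _ => false

/-- The token in the register starts the string of a variable. -/
def isVar : Option Cell → Bool
  | some (.sym .var) => true
  | _ => false

/-- Push a symbol of a variable. -/
def letterBlock : Block St TermSymbol TermSymbol Stk Cell :=
  .branch (fun v => isVar v.1)
    (.push .val (fun _ => .sgn true) (.load (fun v => (v.1, false)) .done))
    (.push .val reg .done)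

/-- Process a token. -/
def tokenStep : Program :=
  .ite (fun v => isInv v.1) invTop (.ite (fun v => isMul v.1) concatTop
    (.blk (.branch (fun v => isOne v.1) (.push .val (fun _ => .sep) .done)
      (.branch (fun v => v.2) letterBlock
        (.push .val (fun _ => .sep) (.push .val (fun _ => .sgn true)
          (.load (fun v => (v.1, true)) letterBlock)))))))

/-- Process the tokens, the first of which is already in the register. -/
def tokenLoop : Program :=
  .loop (fun v => v.1.isSome) (.seq tokenStep (.blk (.pop .tok setReg .done)))

/-- The state of `tokenLoop` with tokens `r`. -/
def tokSt (r : List TermSymbol) (b : Bool) : St := (r.head?.map .sym, b)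

/-- The store of `tokenLoop` with tokens `r` and word stack `z`. -/
def tokSto (o : List TermSymbol) (r : List TermSymbol) (z : List Cell) : Sto :=
  ⟨[], o, stk (r.tail.map .sym) z [] [] []⟩

/-- The rest of the run is a hypothesis, here and in the lemmas that follow: a run of the loop is
assembled from its end to its start, so it never has to be split. -/
theorem exec_tokenLoop_step {c : TermSymbol} {r o : List TermSymbol} {z z' : List Cell} {b b' : Bool}
    {v' S' n t} {x : Option Cell}
    (h : Exec tokenStep (some (.sym c), b) ⟨[], o, stk (r.map .sym) z [] [] []⟩ (x, b')
      ⟨[], o, stk (r.map .sym) z' [] [] []⟩ n)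
    (h' : Exec tokenLoop (tokSt r b') (tokSto o r z') v' S' t) :
    Exec tokenLoop (tokSt (c :: r) b) (tokSto o (c :: r) z) v' S' (t + n + 2) := by
  refine (Exec.loop_true rfl (Exec.seq h (Exec.block ?_)) h').congr rfl rfl (by omega)
  simp [tokSt, tokSto, ← List.map_tail]

theorem exec_tokenLoop_bits (o : List TermSymbol) (l : List Bool) {r : List TermSymbol} {z : List Cell}
    {v' S' t} (h : Exec tokenLoop (tokSt r true)
      (tokSto o r ((l.map fun b => .sym (.bit b)).reverse ++ z)) v' S' t) :
    Exec tokenLoop (tokSt (l.map .bit ++ r) true) (tokSto o (l.map .bit ++ r) z) v' S'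
      (t + 5 * l.length) := by
  induction l generalizing z with
  | nil => exact h
  | cons b l ih =>
    have h1 := ih (z := .sym (.bit b) :: z) (by simpa using h)
    refine (exec_tokenLoop_step (c := .bit b) (x := some (.sym (.bit b)))
      (Exec.ite_false rfl (Exec.ite_false rfl (Exec.block ?_))) h1).congr rfl rfl (by simp; omega)
    simp [isOne, isVar, letterBlock]

theorem exec_tokenLoop_var (o : List TermSymbol) (n : ℕ) {r : List TermSymbol} {z : List Cell}
    {v' S' t} (h : Exec tokenLoop (tokSt r false)
      (tokSto o r (letterString (true, n) ++ .sep :: z)) v' S' t) :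
    Exec tokenLoop (tokSt ((encodeVar n).reverse ++ r) false)
      (tokSto o ((encodeVar n).reverse ++ r) z) v' S' (t + 5 * (encodeVar n).length) := by
  rw [length_bits]
  simp only [letterString, bits, encodeVar, List.length_map, ite_true] at h ⊢
  rw [← List.length_reverse]
  rw [show Computability.encodeNat n = (Computability.encodeNat n).reverse.reverse by simp] at h
  rw [List.reverse_cons, ← List.map_reverse]
  generalize (Computability.encodeNat n).reverse = l at h ⊢
  -- Read backwards, the bits precede `var`, and the first bit opens the letter. A variable without
  -- bits, such as `x_0`, is opened and closed by `var` itself.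
  rcases l with _ | ⟨b, l⟩
  · refine (exec_tokenLoop_step (c := .var) (x := some (.sym .var))
      (Exec.ite_false rfl (Exec.ite_false rfl (Exec.block ?_))) h).congr rfl rfl (by simp)
    simp [isOne, isVar, letterBlock]
  · have h1 : Exec tokenLoop (tokSt (.var :: r) true) (tokSto o (.var :: r)
        ((l.map fun b => .sym (.bit b)).reverse ++ .sym (.bit b) :: .sgn true :: .sep :: z)) v' S'
        (t + 5) := by
      refine (exec_tokenLoop_step (c := .var) (x := some (.sym .var))
        (Exec.ite_false rfl (Exec.ite_false rfl (Exec.block ?_))) h).congr rfl rfl (by simp)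
      simp [isOne, isVar, letterBlock, Function.comp_def]
    simp only [List.map_cons, List.cons_append, List.append_assoc, List.nil_append]
    refine (exec_tokenLoop_step (c := .bit b) (x := some (.sym (.bit b)))
      (Exec.ite_false rfl (Exec.ite_false rfl (Exec.block ?_)))
      (exec_tokenLoop_bits o l h1)).congr rfl rfl ?_
    · simp [isOne, isVar, letterBlock]
    · simp
      omega

/-- Polish notation read backwards is a postfix notation, so the words of the operands are on top of
the stack when their operation is met. Each operation moves a word of linear length, which gives the
quadratic bound. -/
theorem exec_tokenLoop_term (o : List TermSymbol) (p : GroupTerm) {r : List TermSymbol} {z : List Cell}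
    {v' S' t} (h : Exec tokenLoop (tokSt r false)
      (tokSto o r (wordString p.signedWord ++ .sep :: z)) v' S' t) :
    Exec tokenLoop (tokSt (p.encode.reverse ++ r) false)
      (tokSto o (p.encode.reverse ++ r) z) v' S' (t + 20 * p.encode.length ^ 2) := by
  induction p generalizing r z t with
  | var n =>
    refine (exec_tokenLoop_var o n (by simpa [GroupTerm.signedWord, wordString] using h)).congr
      rfl rfl ?_
    simp only [GroupTerm.encode, length_bits]
    nlinarith
  | one =>
    refine (exec_tokenLoop_step (c := .one) (x := some (.sym .one))
      (Exec.ite_false rfl (Exec.ite_false rfl (Exec.block ?_))) h).congr rfl rfl ?_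
    · simp [isOne, GroupTerm.signedWord, wordString]
    · simp [GroupTerm.encode]
  | inv p ih =>
    rw [GroupTerm.signedWord, ← reverse_flip_wordString] at h
    have h1 := ih (exec_tokenLoop_step (c := .inv) (Exec.ite_true rfl
      (exec_invTop _ _ _ (fun c hc => isSep_of_mem_wordString hc) _ _ _)) h)
    simp only [GroupTerm.encode, List.reverse_cons, List.append_assoc, List.singleton_append]
    refine h1.congr rfl rfl ?_
    have := length_wordString_signedWord p
    simp only [List.length_cons]
    nlinarith
  | mul p q hp hq =>
    rw [GroupTerm.signedWord, wordString_append, List.append_assoc] at h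
    have h1 := hq (hp (exec_tokenLoop_step (c := .mul) (Exec.ite_false rfl (Exec.ite_true rfl
      (exec_concatTop _ _ _ (fun c hc => isSep_of_mem_wordString hc) _ _ _))) h))
    simp only [GroupTerm.encode, List.reverse_cons, List.append_assoc, List.singleton_append,
      List.reverse_append]
    refine h1.congr rfl rfl ?_
    have := length_wordString_signedWord p
    simp only [List.length_cons, List.length_append]
    nlinarith [Nat.zero_le (p.encode.length * q.encode.length)]

/-! #### Writing the semigroup terms -/

/-- Write the symbols on stack `a`, moving them to stack `b`, and then write the symbols which
precede the bits of a variable in a comb. -/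
def spill (a b : Stk) : Program :=
  .seq (.blk (.pop a setReg .done))
    (.seq (.loop (fun v => v.1.isSome)
        (.blk (.push b reg (.write (fun v => v.1.elim .sep fun c => match c with
          | .sym c => c
          | _ => .sep) (.pop a setReg .done)))))
      (.blk (.write (fun _ => .var) (.write (fun _ => .mul) .done))))

theorem exec_spill {a b : Stk} (hab : a ≠ b) (x : List TermSymbol) (v : St) (S : Sto)
    (hS : S.wk a = x.map .sym) :
    Exec (spill a b) v S (none, v.2)
      ⟨S.inp, .mul :: .var :: (x.reverse ++ S.out), Function.update (Function.update S.wk a []) b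
        ((x.map .sym).reverse ++ S.wk b)⟩ (2 * x.length + 3) := by
  have key : ∀ (x : List TermSymbol) (B : List Cell) (o : List TermSymbol),
      Exec (.loop (fun v => v.1.isSome)
        (.blk (.push b reg (.write (fun v => v.1.elim .sep fun c => match c with
          | .sym c => c
          | _ => .sep) (.pop a setReg .done)))) : Program)
        ((x.map Cell.sym).head?, v.2)
        ⟨S.inp, o, Function.update (Function.update S.wk a (x.map .sym).tail) b B⟩
        (none, v.2) ⟨S.inp, x.reverse ++ o, Function.update (Function.update S.wk a []) b
          ((x.map .sym).reverse ++ B)⟩ (2 * x.length + 1) := by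
    intro x
    induction x with
    | nil => exact fun B o => Exec.loop_false rfl
    | cons c x ih =>
      intro B o
      refine (Exec.loop_true rfl (Exec.block ?_) (ih (.sym c :: B) (c :: o))).congr rfl ?_ ?_
      · refine Prod.ext ?_ (congrArg (Store.mk _ _) (funext fun k => ?_))
        · simp [hab]
        · by_cases h1 : k = a
          · subst h1
            simp [hab]
          · by_cases h2 : k = b
            · subst h2
              simp [h1]
            · simp [h1, h2]
      · simp
      · simp
        omega
  have h := key x (S.wk b) S.out
  rw [← hS, Function.update_eq_self_iff.2] at h
  · refine (Exec.seq (Exec.block rfl) (Exec.seq h (Exec.block rfl))).congr rfl ?_ (by omega)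
    simp [hS]
  · simp [hab.symm]

/-- Write the letter whose bits are on stack `a` a number of times, and empty this stack. -/
def writeLetter (a b : Stk) (m : ℕ) : Program :=
  .seq (repeatProg (.seq (spill a b) (move b a)) m) (clear a)

theorem exec_writeLetter {a b : Stk} (hab : a ≠ b) (x : List TermSymbol) (m : ℕ) (v : St) (S : Sto)
    (hS : S.wk a = x.map .sym) (hb : S.wk b = []) :
    Exec (writeLetter a b m) v S (none, v.2)
      ⟨S.inp, (List.replicate m (.mul :: .var :: x.reverse)).flatten ++ S.out,
        Function.update S.wk a []⟩ ((m + 1) * (4 * x.length + 5)) := by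
  have key : ∀ (m : ℕ) (v : Option Cell) (v₂ : Bool) (o : List TermSymbol),
      ∃ v', Exec (repeatProg (.seq (spill a b) (move b a)) m) (v, v₂) ⟨S.inp, o, S.wk⟩ (v', v₂)
        ⟨S.inp, (List.replicate m (.mul :: .var :: x.reverse)).flatten ++ o, S.wk⟩
        (m * (4 * x.length + 5) + 1) := by
    intro m
    induction m with
    | zero => exact fun v v₂ o => ⟨v, (Exec.block rfl).congr rfl (by simp) (by omega)⟩
    | succ m ih =>
      intro v v₂ o
      obtain ⟨v', h⟩ := ih none v₂ (.mul :: .var :: (x.reverse ++ o))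
      refine ⟨v', (Exec.seq (Exec.seq (exec_spill hab x (v, v₂) ⟨S.inp, o, S.wk⟩ hS)
        ((exec_move hab.symm _ _).congr rfl ?_ le_rfl)) h).congr rfl ?_ ?_⟩
      · congr 1
        funext k
        by_cases h1 : k = a
        · subst h1
          simp [hb, hS, hab]
        · by_cases h2 : k = b
          · subst h2
            simp [hb, h1]
          · simp [h1, h2]
      · simp [List.replicate_succ']
      · simp [hb]
        ring_nf
        omega
  obtain ⟨v', h⟩ := key m v.1 v.2 S.out
  refine (Exec.seq h (exec_clear _ _ _)).congr rfl rfl ?_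
  simp [hS]
  ring_nf
  omega

/-- The delimiter in the register belongs to a positive letter. -/
def isPos : Option Cell → Bool
  | some (.sgn s) => s
  | _ => false

/-- The register contains a delimiter. -/
def isSgn : Option Cell → Bool
  | some (.sgn _) => true
  | _ => false

/-- Process a symbol of the string of a word read backwards. -/
def cellStep (m : ℕ) : Program :=
  .seq (.blk (.push .val reg .done))
    (.ite (fun v => isSgn v.1)
      (.ite (fun v => v.2)
        (.seq (.blk (.load (fun v => (v.1, false)) .done))
          (.ite (fun v => isPos v.1)
            (.seq (move .buf .aux) (writeLetter .aux .buf 1))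
            (writeLetter .buf .aux m)))
        (.blk (.load (fun v => (v.1, true)) .done)))
      (.blk (.push .buf reg .done)))

/-- Process the string of a word read backwards, the first symbol of which is in the register. -/
def cellLoop (m : ℕ) : Program :=
  .loop (fun v => v.1.isSome) (.seq (cellStep m) (.blk (.pop .tmp setReg .done)))

/-- The string written for a signed letter. -/
def output (m : ℕ) (a : Bool × ℕ) : List TermSymbol :=
  (List.replicate (if a.1 then 1 else m) (.mul :: encodeVar a.2)).flatten

theorem exec_cellLoop_step {m : ℕ} {c : Cell} {t z z' y y' : List Cell} {i o o' : List TermSymbol}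
    {b b' : Bool} {v' S' n k} {x : Option Cell}
    (h : Exec (cellStep m) (some c, b) ⟨i, o, stk [] z t y []⟩ (x, b')
      ⟨i, o', stk [] z' t y' []⟩ n)
    (h' : Exec (cellLoop m) (t.head?, b') ⟨i, o', stk [] z' t.tail y' []⟩ v' S' k) :
    Exec (cellLoop m) (some c, b) ⟨i, o, stk [] z t y []⟩ v' S' (k + n + 2) := by
  refine (Exec.loop_true rfl (Exec.seq h (Exec.block ?_)) h').congr rfl rfl (by omega)
  simp

theorem exec_cellLoop_bits {m : ℕ} (l : List TermSymbol) {t z y : List Cell} {i o : List TermSymbol}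
    {v' S' k}
    (h : Exec (cellLoop m) (t.head?, true)
      ⟨i, o, stk [] ((l.map .sym).reverse ++ z) t.tail ((l.map .sym).reverse ++ y) []⟩ v' S' k) :
    Exec (cellLoop m) ((l.map Cell.sym ++ t).head?, true)
      ⟨i, o, stk [] z (l.map Cell.sym ++ t).tail y []⟩ v' S' (k + 5 * l.length) := by
  induction l generalizing z y with
  | nil => exact h
  | cons c l ih =>
    have h1 := ih (z := .sym c :: z) (y := .sym c :: y) (by simpa using h)
    refine (exec_cellLoop_step (x := some (.sym c))
      (Exec.seq (Exec.block rfl) (Exec.ite_false rfl (Exec.block ?_))) h1).congr rfl rfl ?_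
    · simp
    · simp
      omega

/-- The output grows at its front, so the last bit of a variable has to be written first. On `.buf`
a positive letter has its first bit on top and needs one more reversal, to `.aux`; a negative
letter, stored backwards, is already in the right order. -/
theorem exec_cellLoop_letter {m : ℕ} (a : Bool × ℕ) {t z : List Cell} {i o : List TermSymbol}
    {v' S' k}
    (h : Exec (cellLoop m) (t.head?, false)
      ⟨i, output m a ++ o, stk [] (letterString a ++ z) t.tail [] []⟩ v' S' k) :
    Exec (cellLoop m) (((letterString a).reverse ++ t).head?, false)
      ⟨i, o, stk [] z ((letterString a).reverse ++ t).tail [] []⟩ v' S'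
      (k + 20 * (m + 2) * (letterString a).length) := by
  obtain ⟨s, n⟩ := a
  set X : List TermSymbol := if s then (bits n).reverse else bits n with hX
  have hr : (letterString (s, n)).reverse = .sgn s :: (X.map Cell.sym ++ [.sgn s]) := by
    cases s <;> simp [letterString, hX]
  have hl : letterString (s, n) = .sgn s :: ((X.map Cell.sym).reverse ++ [.sgn s]) := by
    cases s <;> simp [letterString, hX]
  have hlen : (letterString (s, n)).length = X.length + 2 := by simp [hl]
  have h1 : Exec (cellLoop m) (some (.sgn s), true)
      ⟨i, o, stk [] ((X.map .sym).reverse ++ .sgn s :: z) t ((X.map .sym).reverse ++ []) []⟩ v' S'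
      (k + ((m + 2) * (4 * X.length + 5) + 2 * X.length + 9) + 2) := by
    refine (exec_cellLoop_step (x := none) (b' := false) (o' := output m (s, n) ++ o) (y' := [])
      (Exec.seq (Exec.block rfl) (Exec.ite_true rfl (Exec.ite_true rfl
        (Exec.seq (Exec.block rfl) (?_ : Exec _ _ _ _ _
          ((m + 2) * (4 * X.length + 5) + 2 * X.length + 3)))))) h).congr rfl rfl (by omega)
    cases s with
    | true =>
      refine (Exec.ite_true rfl (Exec.seq (exec_move (by decide) _ _)
        (exec_writeLetter (by decide) X 1 _ _ ?_ ?_))).congr rfl ?_ ?_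
      · simp
      · simp
      · simp [hl, output, encodeVar, bits, hX]
      · simp
        nlinarith [Nat.zero_le (m * X.length)]
    | false =>
      refine (Exec.ite_false rfl
        (exec_writeLetter (by decide) X.reverse m _ _ ?_ ?_)).congr rfl ?_ ?_
      · simp
      · simp
      · simp [hl, output, encodeVar, bits, hX]
      · simp
        nlinarith [Nat.zero_le (m * X.length)]
  have h2 := exec_cellLoop_bits (t := .sgn s :: t) X h1
  rw [hr]
  simp only [List.cons_append, List.append_assoc, List.nil_append, List.head?_cons, List.tail_cons]
  refine (exec_cellLoop_step (x := some (.sgn s)) (Exec.seq (Exec.block rfl) (Exec.ite_true rfl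
    (Exec.ite_false rfl (Exec.block ?_)))) h2).congr rfl ?_ ?_
  · simp
  · simp
  · rw [hlen]
    nlinarith [Nat.zero_le (m * X.length)]

theorem exec_cellLoop {m : ℕ} (w : List (Bool × ℕ)) (z : List Cell) (i o : List TermSymbol) :
    Exec (cellLoop m) ((wordString w).reverse.head?, false)
      ⟨i, o, stk [] z (wordString w).reverse.tail [] []⟩ (none, false)
      ⟨i, w.flatMap (output m) ++ o, stk [] (wordString w ++ z) [] [] []⟩
      (20 * (m + 2) * (wordString w).length + 1) := by
  induction w using List.reverseRecOn generalizing z o with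
  | nil => exact (Exec.loop_false rfl).congr rfl rfl (by simp)
  | append_singleton w a ih =>
    have e : wordString (w ++ [a]) = wordString w ++ letterString a := by simp [wordString]
    rw [e, List.reverse_append]
    refine (exec_cellLoop_letter a (ih (letterString a ++ z) (output m a ++ o))).congr rfl ?_ ?_
    · simp
    · simp
      ring_nf
      omega

/-- Write the letters of a word and restore its string. -/
def writeWord (m : ℕ) : Program :=
  .seq (.blk (.pop .tmp setReg .done)) (.seq (cellLoop m) (move .val .tmp))

theorem exec_writeWord {m : ℕ} (w : List (Bool × ℕ)) (v : Option Cell) (i o : List TermSymbol) :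
    Exec (writeWord m) (v, false) ⟨i, o, stk [] [] (wordString w).reverse [] []⟩ (none, false)
      ⟨i, w.flatMap (output m) ++ o, stk [] [] (wordString w).reverse [] []⟩
      (20 * (m + 3) * (wordString w).length + 4) := by
  refine (Exec.seq (Exec.block ?_) (Exec.seq (exec_cellLoop w [] i o) (exec_move ?_ _ _))).congr
    rfl ?_ ?_
  · simp
  · decide
  · simp
  · simp
    ring_nf
    omega

/-- The program computing `powerPair`. -/
def program (m : ℕ) : Program :=
  .seq readInput (.seq (.blk (.pop .tok setReg .done)) (.seq tokenLoop (.seq concatTop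
    (.seq (transfer .val .tmp isSep id) (.seq (.blk (.write (fun _ => .var) .done))
      (.seq (writeWord m) (.seq (writeWord m)
        (.seq (.blk (.write (fun _ => .sep) (.write (fun _ => .var) .done)))
          (.seq (writeWord m) (.seq (writeWord m) (.seq (writeWord m) (clear .tmp))))))))))))

/-- A right comb is encoded leaf by leaf, each leaf preceded by its own `mul`, so that it can be
written without keeping track of a tree. -/
theorem encode_comb (m : ℕ) (w : List (Bool × ℕ)) (l : List ℕ) :
    (comb (expand m w ++ l)).encode = w.flatMap (output m) ++ (comb l).encode := by
  have h1 : ∀ (k : ℕ) (x : ℕ) (l : List ℕ), (comb (List.replicate k x ++ l)).encode =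
      (List.replicate k (.mul :: encodeVar x)).flatten ++ (comb l).encode := by
    intro k x l
    induction k with
    | zero => rfl
    | succ k ih =>
      rw [List.replicate_succ, List.replicate_succ, List.flatten_cons, List.append_assoc, ← ih]
      rfl
  induction w with
  | nil => rfl
  | cons a w ih =>
    rw [expand, List.flatMap_cons, ← expand, List.append_assoc, h1, ih]
    simp [output]

theorem powerPair_computable (m : ℕ) :
    Nonempty (Turing.TM2ComputableInPolyTime
      (fun st : GroupTerm × GroupTerm => st.1.encode ++ TermSymbol.sep :: st.2.encode)
      (fun pq : SemigroupTerm × SemigroupTerm => pq.1.encode ++ TermSymbol.sep :: pq.2.encode)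
      (powerPair m)) := by
  refine computableInPolyTime_of_exec (program m) (none, false)
    (Polynomial.C (1000 * (m + 3)) * (Polynomial.X + 1) ^ 2) fun st => ?_
  obtain ⟨s, t⟩ := st
  set inp := s.encode ++ TermSymbol.sep :: t.encode with hinp
  have hw : quotientWord s t = s.signedWord ++ (t.signedWord.map fun a => (!a.1, a.2)).reverse := rfl
  have h0 : Exec tokenLoop (tokSt [] false)
      (tokSto [] [] (wordString s.signedWord ++ .sep ::
        (((wordString t.signedWord).map flipCell).reverse ++ [.sep]))) (none, false)
      (tokSto [] [] (wordString s.signedWord ++ .sep ::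
        (((wordString t.signedWord).map flipCell).reverse ++ [.sep]))) 1 := Exec.loop_false rfl
  -- The separator is processed as an inversion. Read backwards it follows `t`, whose word it
  -- inverts; the word of `s` is then stacked on top, and `concatTop` joins the two to a word for `s
  -- * t⁻¹`.
  have h1 := exec_tokenLoop_term [] t (exec_tokenLoop_step (c := .sep) (Exec.ite_true rfl
    (exec_invTop _ _ [] (fun c hc => isSep_of_mem_wordString hc) _ _ _))
    (exec_tokenLoop_term [] s h0))
  have hrev : t.encode.reverse ++ TermSymbol.sep :: (s.encode.reverse ++ []) = inp.reverse := by
    simp [hinp]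
  rw [hrev] at h1
  rw [reverse_flip_wordString] at h1
  have h2 := exec_concatTop (wordString s.signedWord) []
    (wordString ((t.signedWord.map fun a => (!a.1, a.2)).reverse) ++ [.sep])
    (fun c hc => isSep_of_mem_wordString hc) (none, false) [] []
  rw [← List.append_assoc, ← wordString_append, ← hw] at h2
  have h3 := exec_transfer (ι := TermSymbol) (ω := TermSymbol) (F := Bool) (g := id)
    (show Stk.val ≠ Stk.tmp by decide) (wordString (quotientWord s t)) [.sep]
    (fun c hc => isSep_of_mem_wordString hc) (by simp [isSep]) (none, false)
    ⟨[], [], stk [] (wordString (quotientWord s t) ++ [.sep]) [] [] []⟩ rfl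
  simp only [List.tail_cons, update_val, update_tmp, stk_tmp, List.append_nil, List.map_id] at h3
  have h4 := fun v o => exec_writeWord (m := m) (quotientWord s t) v [] o
  have h5 : ∀ o : List TermSymbol,
      Exec (.blk (.write (fun _ => .sep) (.write (fun _ => .var) .done)) : Program)
      (none, false) ⟨[], o, stk [] [] (wordString (quotientWord s t)).reverse [] []⟩
      (none, false) ⟨[], .var :: .sep :: o,
        stk [] [] (wordString (quotientWord s t)).reverse [] []⟩ 1 := fun o => Exec.block rfl
  have h6 : Exec (.blk (.write (fun _ => .var) .done) : Program) (some .sep, false)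
      ⟨[], [], stk [] [] (wordString (quotientWord s t)).reverse [] []⟩ (some .sep, false)
      ⟨[], [.var], stk [] [] (wordString (quotientWord s t)).reverse [] []⟩ 1 := Exec.block rfl
  have hlen : (wordString (quotientWord s t)).length ≤ 2 * inp.length := by
    have e1 := length_wordString_signedWord s
    have e2 := length_wordString_signedWord t
    rw [hw, wordString_append, ← reverse_flip_wordString]
    simp [hinp]
    omega
  have hlen' : (wordString s.signedWord).length ≤ 2 * inp.length := by
    have e1 := length_wordString_signedWord s
    simp [hinp]
    omega
  refine ⟨(none, false), ?_⟩
  rw [← stk_nil]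
  -- The output is written from its end: first `w ^ 2 * x_0`, then the separator, then `w ^ 3 *
  -- x_0`, each term beginning with its last leaf.
  refine (Exec.seq (exec_readInput inp [] false none) (Exec.seq (Exec.block ?_) (Exec.seq h1
    (Exec.seq h2 (Exec.seq h3 (Exec.seq h6
      (Exec.seq (h4 _ _) (Exec.seq (h4 _ _)
      (Exec.seq (h5 _) (Exec.seq (h4 _ _) (Exec.seq (h4 _ _) (Exec.seq (h4 _ _)
        (exec_clear .tmp _ _))))))))))))).congr rfl ?_ ?_
  · simp [tokSt, tokSto]
  · have e0 : (comb []).encode = [.var] := by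
      simp [comb, SemigroupTerm.encode, encodeVar, Computability.encodeNat, Computability.encodeNum]
    have e1 := encode_comb m (quotientWord s t) []
    have e2 := encode_comb m (quotientWord s t) (expand m (quotientWord s t))
    have e3 := encode_comb m (quotientWord s t)
      (expand m (quotientWord s t) ++ expand m (quotientWord s t))
    rw [List.append_nil] at e1
    simp only [powerPair, List.append_assoc, e1, e2, e3, e0]
    simp
  · have hL : inp.length = s.encode.length + t.encode.length + 1 := by
      simp [hinp]
      omega
    have e1 := length_wordString_signedWord s
    have e2 := length_wordString_signedWord t
    simp only [Polynomial.eval_mul, Polynomial.eval_C, Polynomial.eval_pow, Polynomial.eval_add,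
      Polynomial.eval_X, Polynomial.eval_one, stk_tmp, List.length_reverse]
    have e3 : 20 * (m + 3) * (wordString (quotientWord s t)).length ≤
        40 * (m + 3) * inp.length := by
      calc _ ≤ 20 * (m + 3) * (2 * inp.length) := by gcongr
        _ = _ := by ring
    have e4 : s.encode.length ^ 2 + t.encode.length ^ 2 ≤ inp.length ^ 2 := by
      rw [hL]
      nlinarith [Nat.zero_le (s.encode.length * t.encode.length)]
    nlinarith [Nat.zero_le (m * inp.length), Nat.zero_le (m * inp.length ^ 2)]

end GroupTermMachine

/-! ### A machine deciding whether factors are covered -/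

/-- Search `V` for a factor `x w y` such that all letters of `w` are in `ds`. -/
def scanFactor {α : Type*} [BEq α] (x : α) (ds : List α) (y : α) (V : List α) (s : Bool × Bool) :
    Bool × Bool :=
  V.foldl (fun s z => (z == x || (s.1 && ds.contains z), s.2 || (s.1 && z == y))) s

/-- All factors `x w y` with `w y` a prefix of `R` are covered in `V`, where the letters in `ds` are
free. -/
def coveredFrom {α : Type*} [BEq α] (x : α) : List α → List α → List α → Bool
  | _, [], _ => true
  | ds, y :: R, V => (scanFactor x ds y V (false, false)).2 && coveredFrom x (y :: ds) R V

/-- Decide whether the factors of a word are covered by another word. -/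
def covered {α : Type*} [BEq α] : List α → List α → Bool
  | [], _ => true
  | x :: R, V => coveredFrom x [] R V && covered R V

/-- The first flag says that a factor is open, that is, an `x` has been passed and since then only
letters of `ds`; the second says that a factor has been completed. The middle alternative accounts
for a factor already open at the start. -/
theorem scanFactor_eq_true_iff {α : Type*} [BEq α] [LawfulBEq α] (x : α) (ds : List α) (y : α)
    (V : List α) (s : Bool × Bool) :
    (scanFactor x ds y V s).2 = true ↔ s.2 = true ∨
      (s.1 = true ∧ ∃ w b, V = w ++ y :: b ∧ ∀ z ∈ w, z ∈ ds) ∨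
      ∃ w, HasFactor x w y V ∧ ∀ z ∈ w, z ∈ ds := by
  induction V generalizing s with
  | nil => simp [scanFactor, HasFactor]
  | cons v V ih =>
    rw [scanFactor, List.foldl_cons, ← scanFactor, ih]
    simp only [Bool.or_eq_true, Bool.and_eq_true, beq_iff_eq, List.contains_iff_mem]
    constructor
    · rintro ((h | ⟨h1, rfl⟩) | ⟨rfl | ⟨h1, h2⟩, w, b, rfl, hw⟩ | ⟨w, ⟨a, b, rfl⟩, hw⟩)
      · exact Or.inl h
      · exact Or.inr (Or.inl ⟨h1, [], V, rfl, by simp⟩)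
      · exact Or.inr (Or.inr ⟨w, ⟨[], b, rfl⟩, hw⟩)
      · refine Or.inr (Or.inl ⟨h1, v :: w, b, rfl, ?_⟩)
        simpa [h2] using hw
      · exact Or.inr (Or.inr ⟨w, ⟨v :: a, b, rfl⟩, hw⟩)
    · rintro (h | ⟨h1, w, b, e, hw⟩ | ⟨w, ⟨a, b, e⟩, hw⟩)
      · exact Or.inl (Or.inl h)
      · rcases w with _ | ⟨c, w⟩
        · obtain ⟨rfl, rfl⟩ := List.cons.inj e
          exact Or.inl (Or.inr ⟨h1, rfl⟩)
        · obtain ⟨rfl, rfl⟩ := List.cons.inj e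
          exact Or.inr (Or.inl ⟨Or.inr ⟨h1, hw _ (by simp)⟩, w, b, rfl,
            fun z hz => hw z (by simp [hz])⟩)
      · rcases a with _ | ⟨c, a⟩
        · obtain ⟨rfl, rfl⟩ := List.cons.inj e
          exact Or.inr (Or.inl ⟨Or.inl rfl, w, b, rfl, hw⟩)
        · obtain ⟨rfl, rfl⟩ := List.cons.inj e
          exact Or.inr (Or.inr ⟨w, ⟨a, b, rfl⟩, hw⟩)

/-- The letters passed since `x` are collected in `ds`, which is therefore the set of letters
allowed inside a matching factor. -/
theorem coveredFrom_eq_true_iff {α : Type*} [BEq α] [LawfulBEq α] (x : α) (ds R V : List α) :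
    coveredFrom x ds R V = true ↔ ∀ w y b, R = w ++ y :: b →
      ∃ w', HasFactor x w' y V ∧ ∀ z ∈ w', z ∈ ds ∨ z ∈ w := by
  induction R generalizing ds with
  | nil => simp [coveredFrom]
  | cons y R ih =>
    rw [coveredFrom, Bool.and_eq_true, ih, scanFactor_eq_true_iff]
    simp only [Bool.false_eq_true, false_and, false_or]
    constructor
    · rintro ⟨h1, h2⟩ w y' b e
      rcases w with _ | ⟨c, w⟩
      · obtain ⟨rfl, rfl⟩ := List.cons.inj e
        obtain ⟨w', h3, h4⟩ := h1
        exact ⟨w', h3, fun z hz => Or.inl (h4 z hz)⟩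
      · obtain ⟨rfl, rfl⟩ := List.cons.inj e
        obtain ⟨w', h3, h4⟩ := h2 w y' b rfl
        refine ⟨w', h3, fun z hz => ?_⟩
        have := h4 z hz
        simp only [List.mem_cons] at this ⊢
        tauto
    · intro h
      constructor
      · obtain ⟨w', h3, h4⟩ := h [] y R rfl
        exact ⟨w', h3, by simpa using h4⟩
      · rintro w y' b rfl
        obtain ⟨w', h3, h4⟩ := h (y :: w) y' b rfl
        refine ⟨w', h3, fun z hz => ?_⟩
        have := h4 z hz
        simp only [List.mem_cons] at this ⊢
        tauto

theorem covered_eq_true_iff {α : Type*} [BEq α] [LawfulBEq α] (U V : List α) :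
    covered U V = true ↔ FactorsCovered U V := by
  induction U with
  | nil => simp [covered, FactorsCovered, HasFactor]
  | cons x R ih =>
    rw [covered, Bool.and_eq_true, ih, coveredFrom_eq_true_iff]
    constructor
    · rintro ⟨h1, h2⟩ x' w y ⟨a, b, e⟩
      rcases a with _ | ⟨c, a⟩
      · obtain ⟨rfl, rfl⟩ := List.cons.inj e
        simpa using h1 w y b rfl
      · obtain ⟨rfl, rfl⟩ := List.cons.inj e
        exact h2 x' w y ⟨a, b, rfl⟩
    · intro h
      constructor
      · rintro w y b rfl
        simpa using h x w y ⟨[], b, rfl⟩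
      · rintro x' w y ⟨a, b, rfl⟩
        exact h x' w y ⟨x :: a, b, rfl⟩

namespace CoverMachine

open StackProgram

/-- The symbols on the work stacks: input symbols, and the symbol which ends a letter and carries
two marks. -/
inductive Cell : Type
  | sym (c : TermSymbol)
  | mark (m : Bool × Bool)
  deriving Fintype

instance : Inhabited Cell := ⟨.mark (false, false)⟩

/-- The work stacks. -/
inductive Stk : Type
  | cpy
  | src
  | tape
  | alt
  | rest
  | back
  | key
  | kaux
  deriving DecidableEq

instance : Fintype Stk where
  elems := {.cpy, .src, .tape, .alt, .rest, .back, .key, .kaux}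
  complete x := by cases x <;> simp

/-- The contents of the work stacks. -/
def stk (c u v u' b w y y' : List Cell) : Stk → List Cell
  | .cpy => c
  | .src => u
  | .tape => v
  | .alt => u'
  | .rest => b
  | .back => w
  | .key => y
  | .kaux => y'

section

variable (c u v u' b w y y' x : List Cell)

@[simp] theorem stk_cpy : stk c u v u' b w y y' .cpy = c := rfl
@[simp] theorem stk_src : stk c u v u' b w y y' .src = u := rfl
@[simp] theorem stk_tape : stk c u v u' b w y y' .tape = v := rfl
@[simp] theorem stk_alt : stk c u v u' b w y y' .alt = u' := rfl
@[simp] theorem stk_rest : stk c u v u' b w y y' .rest = b := rfl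
@[simp] theorem stk_back : stk c u v u' b w y y' .back = w := rfl
@[simp] theorem stk_key : stk c u v u' b w y y' .key = y := rfl
@[simp] theorem stk_kaux : stk c u v u' b w y y' .kaux = y' := rfl

@[simp] theorem update_cpy :
    Function.update (stk c u v u' b w y y') .cpy x = stk x u v u' b w y y' := by
  funext k; cases k <;> rfl

@[simp] theorem update_src :
    Function.update (stk c u v u' b w y y') .src x = stk c x v u' b w y y' := by
  funext k; cases k <;> rfl

@[simp] theorem update_tape :
    Function.update (stk c u v u' b w y y') .tape x = stk c u x u' b w y y' := by
  funext k; cases k <;> rfl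

@[simp] theorem update_alt :
    Function.update (stk c u v u' b w y y') .alt x = stk c u v x b w y y' := by
  funext k; cases k <;> rfl

@[simp] theorem update_rest :
    Function.update (stk c u v u' b w y y') .rest x = stk c u v u' x w y y' := by
  funext k; cases k <;> rfl

@[simp] theorem update_back :
    Function.update (stk c u v u' b w y y') .back x = stk c u v u' b x y y' := by
  funext k; cases k <;> rfl

@[simp] theorem update_key :
    Function.update (stk c u v u' b w y y') .key x = stk c u v u' b w x y' := by
  funext k; cases k <;> rfl

@[simp] theorem update_kaux :
    Function.update (stk c u v u' b w y y') .kaux x = stk c u v u' b w y x := by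
  funext k; cases k <;> rfl

theorem stk_nil : stk [] [] [] [] [] [] [] [] = fun _ => [] := by
  funext k; cases k <;> rfl

end

/-- The finite state of the machine, apart from its register. -/
structure Flags : Type where
  /-- a second register -/
  aux : Option Cell
  /-- the letters compared agree so far -/
  same : Bool
  /-- the scan is inside a possible factor -/
  active : Bool
  /-- the scan has found a factor -/
  found : Bool
  /-- all factors so far are covered -/
  ok : Bool
  /-- there are more letters -/
  more : Bool
  deriving Fintype

/-- The finite state. -/
abbrev St : Type := Option Cell × Flags

/-- Programs of the machine. -/
abbrev Program (ω : Type) : Type := Prog St TermSymbol ω Stk Cell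

/-- The cell of a bit. -/
abbrev bitCell (b : Bool) : Cell := .sym (.bit b)

/-- The string of a word whose letters carry marks. -/
def tapeString (L : List (List Bool × (Bool × Bool))) : List Cell :=
  L.flatMap fun a => a.1.map bitCell ++ [.mark a.2]

theorem tapeString_cons (a : List Bool × (Bool × Bool)) (L : List (List Bool × (Bool × Bool))) :
    tapeString (a :: L) = a.1.map bitCell ++ .mark a.2 :: tapeString L := by
  simp [tapeString]

/-- The length of the string of a word. -/
def tapeLength (L : List (List Bool)) : ℕ := (L.map fun z => z.length + 1).sum

theorem tapeLength_cons (z : List Bool) (L : List (List Bool)) :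
    tapeLength (z :: L) = z.length + 1 + tapeLength L := by
  simp [tapeLength]

theorem length_tapeString (L : List (List Bool)) (m : List Bool → Bool × Bool) :
    (tapeString (L.map fun z => (z, m z))).length = tapeLength L := by
  induction L with
  | nil => rfl
  | cons z L ih =>
    rw [List.map_cons, tapeString_cons, tapeLength_cons, ← ih]
    simp
    omega

/-- The symbol in a register. -/
@[simp]
def reg (v : St) : Cell := v.1.getD default

/-- The symbol ends a letter. -/
def isMark : Cell → Bool
  | .mark _ => true
  | _ => false

/-- The marks carried by a symbol. -/
def marks : Cell → Bool × Bool
  | .mark m => m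
  | _ => (false, false)

/-- The two registers contain the same bit. -/
def sameBit : Option Cell → Option Cell → Bool
  | some (.sym (.bit b)), some (.sym (.bit b')) => b == b'
  | _, _ => false

section

variable {ω : Type}

/-! #### Comparing the letters of the tape with a key -/

/-- Compare a bit of the tape with the next bit of the key. -/
def bitBlock : Block St TermSymbol ω Stk Cell :=
  .pop .key (fun v o => (v.1, { v.2 with aux := o }))
    (.load (fun v => (v.1, { v.2 with same := v.2.same && sameBit v.1 v.2.aux }))
      (.push .back reg
        (.branch (fun v => v.2.aux.isSome)
          (.push .kaux (fun v => v.2.aux.getD default) (.pop .tape setReg .done))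
          (.pop .tape setReg .done))))

/-- Change the marks and flags at the end of a letter. -/
def markBlock (updM : Bool → Bool × Bool → Bool × Bool)
    (updF : Bool → Bool × Bool → Bool × Bool → Bool × Bool) : Block St TermSymbol ω Stk Cell :=
  .push .back (fun v => .mark (updM v.2.same (marks (reg v))))
    (.load (fun v => (v.1, ⟨none, true,
      (updF v.2.same (marks (reg v)) (v.2.active, v.2.found)).1,
      (updF v.2.same (marks (reg v)) (v.2.active, v.2.found)).2, v.2.ok, v.2.more⟩)) .done)

/-- Process the end of a letter and restore the key. -/
def markStep (updM : Bool → Bool × Bool → Bool × Bool)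
    (updF : Bool → Bool × Bool → Bool × Bool → Bool × Bool) : Program ω :=
  .seq (.blk (.pop .key (fun v o => (v.1, { v.2 with aux := o }))
      (.branch (fun v => v.2.aux.isSome)
        (.push .key (fun v => v.2.aux.getD default)
          (.load (fun v => (v.1, { v.2 with same := false })) (markBlock updM updF)))
        (markBlock updM updF))))
    (.seq (move .kaux .key) (.blk (.pop .tape setReg .done)))

/-- Compare all letters of the tape with the key. -/
def passLoop (updM : Bool → Bool × Bool → Bool × Bool)
    (updF : Bool → Bool × Bool → Bool × Bool → Bool × Bool) : Program ω :=
  .loop (fun v => v.1.isSome)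
    (.ite (fun v => isMark (reg v)) (markStep updM updF) (.blk bitBlock))

theorem exec_markStep {updM : Bool → Bool × Bool → Bool × Bool}
    {updF : Bool → Bool × Bool → Bool × Bool → Bool × Bool} (r p : List Bool) (e : Bool)
    (m : Bool × Bool) {T B c u u' b : List Cell} {i : List TermSymbol} {o : List ω}
    {x : Option Cell} {a s k mo : Bool} :
    Exec (markStep updM updF) (some (.mark m), ⟨x, e, a, s, k, mo⟩)
      ⟨i, o, stk c u T u' b B (r.map bitCell) (p.map bitCell)⟩
      (T.head?, ⟨none, true, (updF (e && r.isEmpty) m (a, s)).1,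
        (updF (e && r.isEmpty) m (a, s)).2, k, mo⟩)
      ⟨i, o, stk c u T.tail u' b (.mark (updM (e && r.isEmpty) m) :: B)
        ((p.reverse ++ r).map bitCell) []⟩ (2 * p.length + 4) := by
  have h1 : Exec (.blk (.pop .key (fun v o => (v.1, { v.2 with aux := o }))
      (.branch (fun v => v.2.aux.isSome)
        (.push .key (fun v => v.2.aux.getD default)
          (.load (fun v => (v.1, { v.2 with same := false })) (markBlock updM updF)))
        (markBlock updM updF))) : Program ω) (some (.mark m), ⟨x, e, a, s, k, mo⟩)
      ⟨i, o, stk c u T u' b B (r.map bitCell) (p.map bitCell)⟩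
      (some (.mark m), ⟨none, true, (updF (e && r.isEmpty) m (a, s)).1,
        (updF (e && r.isEmpty) m (a, s)).2, k, mo⟩)
      ⟨i, o, stk c u T u' b (.mark (updM (e && r.isEmpty) m) :: B) (r.map bitCell)
        (p.map bitCell)⟩ 1 := by
    apply Exec.block
    rcases r with _ | ⟨b', r⟩ <;> simp [markBlock, marks]
  refine (Exec.seq h1 (Exec.seq (exec_move (by decide) _ _) (Exec.block ?_))).congr rfl rfl ?_
  · simp
  · simp
    omega

/-- In the middle of a comparison, `p` is the part of the key already used, in reverse, `r` the part
still to come, and `e` the verdict so far. A key that is too short fails at the next bit, one that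
is too long fails at the mark. -/
theorem exec_passLoop_letter {updM : Bool → Bool × Bool → Bool × Bool}
    {updF : Bool → Bool × Bool → Bool × Bool → Bool × Bool} (l r p : List Bool) (e : Bool)
    (m : Bool × Bool) {T B c u u' b : List Cell} {i : List TermSymbol} {o : List ω}
    {x : Option Cell} {a s k mo : Bool} {v' S' t}
    (h : Exec (passLoop updM updF) (T.head?, ⟨none, true, (updF (e && l == r) m (a, s)).1,
        (updF (e && l == r) m (a, s)).2, k, mo⟩)
      ⟨i, o, stk c u T.tail u' b (.mark (updM (e && l == r) m) :: ((l.map bitCell).reverse ++ B))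
        ((p.reverse ++ r).map bitCell) []⟩ v' S' t) :
    Exec (passLoop updM updF) ((l.map bitCell ++ .mark m :: T).head?, ⟨x, e, a, s, k, mo⟩)
      ⟨i, o, stk c u (l.map bitCell ++ .mark m :: T).tail u' b B (r.map bitCell)
        (p.map bitCell)⟩ v' S' (t + (5 * l.length + 2 * p.length + 6)) := by
  induction l generalizing r p e B x with
  | nil =>
    have e1 : (([] : List Bool) == r) = r.isEmpty := by cases r <;> rfl
    rw [e1] at h
    exact (Exec.loop_true rfl (Exec.ite_true rfl (exec_markStep r p e m)) h).congr rfl rfl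
      (by simp; omega)
  | cons b' l ih =>
    rcases r with _ | ⟨b'', r⟩
    · have h1 := ih [] p false (B := bitCell b' :: B) (x := none) (by simpa using h)
      refine (Exec.loop_true rfl (Exec.ite_false rfl (Exec.block ?_)) h1).congr rfl rfl ?_
      · simp [bitBlock, sameBit]
      · simp
        omega
    · have h1 := ih r (b'' :: p) (e && b' == b'') (B := bitCell b' :: B) (x := some (bitCell b''))
        (by simpa [Bool.and_assoc] using h)
      refine (Exec.loop_true rfl (Exec.ite_false rfl (Exec.block ?_)) h1).congr rfl rfl ?_
      · simp [bitBlock, sameBit]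
      · simp
        omega

theorem exec_passLoop {updM : Bool → Bool × Bool → Bool × Bool}
    {updF : Bool → Bool × Bool → Bool × Bool → Bool × Bool} (l : List Bool)
    (m : List Bool → Bool × Bool) (V : List (List Bool)) {B c u u' b : List Cell}
    {i : List TermSymbol} {o : List ω} {s : Bool × Bool} {k mo : Bool} :
    Exec (passLoop updM updF) ((tapeString (V.map fun z => (z, m z))).head?,
        ⟨none, true, s.1, s.2, k, mo⟩)
      ⟨i, o, stk c u (tapeString (V.map fun z => (z, m z))).tail u' b B (l.map bitCell) []⟩
      (none, ⟨none, true, (V.foldl (fun s z => updF (z == l) (m z) s) s).1,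
        (V.foldl (fun s z => updF (z == l) (m z) s) s).2, k, mo⟩)
      ⟨i, o, stk c u [] u' b ((tapeString (V.map fun z => (z, updM (z == l) (m z)))).reverse ++ B)
        (l.map bitCell) []⟩ (6 * tapeLength V + 1) := by
  induction V generalizing s B with
  | nil => exact Exec.loop_false rfl
  | cons z V ih =>
    simp only [List.map_cons, tapeString_cons, tapeLength_cons, List.foldl_cons]
    refine (exec_passLoop_letter z l [] true (m z)
      (ih (B := .mark (updM (z == l) (m z)) :: ((z.map bitCell).reverse ++ B)))).congr rfl ?_ ?_
    · simp
    · simp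
      omega

/-- Compare all letters of the tape with the key, and restore the tape. -/
def pass (updM : Bool → Bool × Bool → Bool × Bool)
    (updF : Bool → Bool × Bool → Bool × Bool → Bool × Bool) : Program ω :=
  .seq (.blk (.load (fun v => (v.1, ⟨none, true, false, false, v.2.ok, v.2.more⟩))
    (.pop .tape setReg .done))) (.seq (passLoop updM updF) (move .back .tape))

theorem exec_pass {updM : Bool → Bool × Bool → Bool × Bool}
    {updF : Bool → Bool × Bool → Bool × Bool → Bool × Bool} (l : List Bool)
    (m : List Bool → Bool × Bool) (V : List (List Bool)) {c u u' b : List Cell}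
    {i : List TermSymbol} {o : List ω} {x x' : Option Cell} {e a s k mo : Bool} :
    Exec (pass updM updF) (x, ⟨x', e, a, s, k, mo⟩)
      ⟨i, o, stk c u (tapeString (V.map fun z => (z, m z))) u' b [] (l.map bitCell) []⟩
      (none, ⟨none, true, (V.foldl (fun s z => updF (z == l) (m z) s) (false, false)).1,
        (V.foldl (fun s z => updF (z == l) (m z) s) (false, false)).2, k, mo⟩)
      ⟨i, o, stk c u (tapeString (V.map fun z => (z, updM (z == l) (m z)))) u' b []
        (l.map bitCell) []⟩ (8 * tapeLength V + 4) := by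
  refine (Exec.seq (Exec.block ?_) (Exec.seq (exec_passLoop (s := (false, false)) (B := [])
    (c := c) (u := u) (u' := u') (b := b) (i := i) (o := o) (k := k) (mo := mo) l m V)
    (exec_move (by decide) _ _))).congr rfl ?_ ?_
  · simp
  · simp
  · simp only [stk_back, List.append_nil, List.length_reverse, length_tapeString]
    omega

/-! #### Fetching letters -/

/-- Move the first letter on a stack to the key. -/
def fetch (a : Stk) : Program ω :=
  .seq (transfer a .kaux isMark id)
    (.seq (.blk (.load (fun v => (v.1, { v.2 with more := v.1.isSome })) .done))
      (move .kaux .key))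

theorem isMark_of_mem {l : List Bool} {c : Cell} (hc : c ∈ l.map bitCell) : isMark c = false := by
  obtain ⟨b, -, rfl⟩ := List.mem_map.1 hc
  rfl

theorem exec_fetch_src_nil {c v u' b : List Cell} {i : List TermSymbol} {o : List ω}
    {x x' : Option Cell} {e a s k mo : Bool} :
    Exec (fetch .src) (x, ⟨x', e, a, s, k, mo⟩) ⟨i, o, stk c [] v u' b [] [] []⟩
      (none, ⟨x', e, a, s, k, false⟩) ⟨i, o, stk c [] v u' b [] [] []⟩ 5 := by
  have h := exec_transfer (ι := TermSymbol) (ω := ω) (F := Flags) (g := id) (isEnd := isMark)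
    (show Stk.src ≠ Stk.kaux by decide) [] [] (by simp) (by simp) (x, ⟨x', e, a, s, k, mo⟩)
    ⟨i, o, stk c [] v u' b [] [] []⟩ rfl
  refine (Exec.seq h (Exec.seq (Exec.block rfl) (exec_move (by decide) _ _))).congr rfl ?_ ?_
  · simp
  · simp

theorem exec_fetch_src_cons (l : List Bool) (m : Bool × Bool) {T c v u' b : List Cell}
    {i : List TermSymbol} {o : List ω} {x x' : Option Cell} {e a s k mo : Bool} :
    Exec (fetch .src) (x, ⟨x', e, a, s, k, mo⟩)
      ⟨i, o, stk c (l.map bitCell ++ .mark m :: T) v u' b [] [] []⟩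
      (none, ⟨x', e, a, s, k, true⟩) ⟨i, o, stk c T v u' b [] (l.map bitCell) []⟩
      (4 * l.length + 5) := by
  have h := exec_transfer (ι := TermSymbol) (ω := ω) (F := Flags) (g := id) (isEnd := isMark)
    (show Stk.src ≠ Stk.kaux by decide) (l.map bitCell) (.mark m :: T)
    (fun c hc => isMark_of_mem hc) (by simp [isMark]) (x, ⟨x', e, a, s, k, mo⟩)
    ⟨i, o, stk c (l.map bitCell ++ .mark m :: T) v u' b [] [] []⟩ rfl
  refine (Exec.seq h (Exec.seq (Exec.block rfl) (exec_move (by decide) _ _))).congr rfl ?_ ?_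
  · simp
  · simp
    omega

theorem exec_fetch_rest_nil {c u v u' : List Cell} {i : List TermSymbol} {o : List ω}
    {x x' : Option Cell} {e a s k mo : Bool} :
    Exec (fetch .rest) (x, ⟨x', e, a, s, k, mo⟩) ⟨i, o, stk c u v u' [] [] [] []⟩
      (none, ⟨x', e, a, s, k, false⟩) ⟨i, o, stk c u v u' [] [] [] []⟩ 5 := by
  have h := exec_transfer (ι := TermSymbol) (ω := ω) (F := Flags) (g := id) (isEnd := isMark)
    (show Stk.rest ≠ Stk.kaux by decide) [] [] (by simp) (by simp) (x, ⟨x', e, a, s, k, mo⟩)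
    ⟨i, o, stk c u v u' [] [] [] []⟩ rfl
  refine (Exec.seq h (Exec.seq (Exec.block rfl) (exec_move (by decide) _ _))).congr rfl ?_ ?_
  · simp
  · simp

theorem exec_fetch_rest_cons (l : List Bool) (m : Bool × Bool) {T c u v u' : List Cell}
    {i : List TermSymbol} {o : List ω} {x x' : Option Cell} {e a s k mo : Bool} :
    Exec (fetch .rest) (x, ⟨x', e, a, s, k, mo⟩)
      ⟨i, o, stk c u v u' (l.map bitCell ++ .mark m :: T) [] [] []⟩
      (none, ⟨x', e, a, s, k, true⟩) ⟨i, o, stk c u v u' T [] (l.map bitCell) []⟩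
      (4 * l.length + 5) := by
  have h := exec_transfer (ι := TermSymbol) (ω := ω) (F := Flags) (g := id) (isEnd := isMark)
    (show Stk.rest ≠ Stk.kaux by decide) (l.map bitCell) (.mark m :: T)
    (fun c hc => isMark_of_mem hc) (by simp [isMark]) (x, ⟨x', e, a, s, k, mo⟩)
    ⟨i, o, stk c u v u' (l.map bitCell ++ .mark m :: T) [] [] []⟩ rfl
  refine (Exec.seq h (Exec.seq (Exec.block rfl) (exec_move (by decide) _ _))).congr rfl ?_ ?_
  · simp
  · simp
    omega

/-! #### The main loops -/

/-- Search the tape for a factor from a marked letter to the key, and mark the key as free. -/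
def scanPass : Program ω :=
  pass (fun e m => (m.1, m.2 || e)) (fun e m s => (m.1 || (s.1 && m.2), s.2 || (s.1 && e)))

/-- Mark the letters which are equal to the key. -/
def markPass : Program ω :=
  pass (fun e _ => (e, false)) (fun _ _ s => s)

/-- For all letters `y` of the stack `rest`, check that factors up to `y` are covered. -/
def innerLoop : Program ω :=
  .loop (fun v => v.2.more) (.seq (fetch .rest) (.ite (fun v => v.2.more)
    (.seq scanPass (.seq (clear .key)
      (.blk (.load (fun v => (v.1, { v.2 with ok := v.2.ok && v.2.found })) .done))))
    (.blk .done)))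

/-- The two marks of a letter record whether it equals `x` and whether it lies in `ds`. A pass
searches with the old marks while adding the key to the free letters, as in the recursion of
`coveredFrom`. The final marks are left unspecified, since `markPass` overwrites them. -/
theorem exec_innerLoop (x : List Bool) (ds R V : List (List Bool)) (μ : List Bool → Bool × Bool)
    {c u u' : List Cell} {i : List TermSymbol} {o : List ω} {a s k : Bool} :
    ∃ (m : List Bool → Bool × Bool) (a' s' : Bool), Exec innerLoop (none, ⟨none, true, a, s, k, true⟩)
      ⟨i, o, stk c u (tapeString (V.map fun z => (z, (z == x, ds.contains z)))) u'
        (tapeString (R.map fun z => (z, μ z))) [] [] []⟩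
      (none, ⟨none, true, a', s', k && coveredFrom x ds R V, false⟩)
      ⟨i, o, stk c u (tapeString (V.map fun z => (z, m z))) u' [] [] [] []⟩
      (tapeLength R * (8 * tapeLength V + 20) + 9) := by
  induction R generalizing ds a s k with
  | nil =>
    refine ⟨_, a, s, (Exec.loop_true rfl (Exec.seq exec_fetch_rest_nil
      (Exec.ite_false rfl (Exec.block rfl))) (Exec.loop_false rfl)).congr ?_ rfl ?_⟩
    · simp [coveredFrom]
    · simp
  | cons y R ih =>
    have hm : (V.map fun z => (z, (z == x, ds.contains z || z == y))) =
        V.map fun z => (z, (z == x, (y :: ds).contains z)) := by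
      refine List.map_congr_left fun z _ => ?_
      rw [List.contains_cons, Bool.or_comm]
    obtain ⟨m, a', s', h⟩ := ih (y :: ds)
      (a := (scanFactor x ds y V (false, false)).1) (s := (scanFactor x ds y V (false, false)).2)
      (k := k && (scanFactor x ds y V (false, false)).2)
    rw [← hm] at h
    have h1 := exec_pass (ω := ω) (updM := fun e m => (m.1, m.2 || e))
      (updF := fun e m s => (m.1 || (s.1 && m.2), s.2 || (s.1 && e))) y
      (fun z => (z == x, ds.contains z)) V (c := c) (u := u) (u' := u')
      (b := tapeString (R.map fun z => (z, μ z))) (i := i) (o := o) (x := none) (x' := none)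
      (e := true) (a := a) (s := s) (k := k) (mo := true)
    refine ⟨m, a', s', ?_⟩
    rw [List.map_cons, tapeString_cons]
    refine Exec.congr (Exec.loop_true rfl (Exec.seq (exec_fetch_rest_cons y (μ y)) (Exec.ite_true rfl
      (Exec.seq h1 (Exec.seq (exec_clear Stk.key _ _) (Exec.block ?_))))) h) ?_ rfl ?_
    · simp [scanFactor]
    · simp [coveredFrom, Bool.and_assoc]
    · rw [tapeLength_cons]
      simp
      nlinarith [Nat.zero_le (y.length * tapeLength V)]

/-- Copy the remaining letters of the source to the stack `rest`. -/
def copySource : Program ω :=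
  .seq (move .src .back) (.seq (.blk (.pop .back setReg .done))
    (.loop (fun v => v.1.isSome) (.blk (.push .src reg (.push .rest reg (.pop .back setReg .done))))))

theorem exec_copySource {c u v u' y : List Cell} {i : List TermSymbol} {o : List ω} {x : Option Cell}
    {f : Flags} :
    Exec copySource (x, f) ⟨i, o, stk c u v u' [] [] y []⟩ (none, f)
      ⟨i, o, stk c u v u' u [] y []⟩ (4 * u.length + 4) := by
  have key : ∀ B u b : List Cell,
      Exec (.loop (fun v => v.1.isSome)
        (.blk (.push .src reg (.push .rest reg (.pop .back setReg .done)))) : Program ω)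
        (B.head?, f) ⟨i, o, stk c u v u' b B.tail y []⟩ (none, f)
        ⟨i, o, stk c (B.reverse ++ u) v u' (B.reverse ++ b) [] y []⟩ (2 * B.length + 1) := by
    intro B
    induction B with
    | nil => exact fun u b => Exec.loop_false rfl
    | cons d B ih =>
      intro u b
      refine (Exec.loop_true rfl (Exec.block ?_) (ih (d :: u) (d :: b))).congr rfl ?_ ?_
      · simp
      · simp
      · simp
        omega
  refine (Exec.seq (exec_move (by decide) _ _) (Exec.seq (Exec.block ?_)
    (key u.reverse [] []))).congr rfl ?_ ?_
  · simp
  · simp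
  · simp
    omega

/-- Check that the factors of the source are covered by the tape. -/
def outerLoop : Program ω :=
  .loop (fun v => v.2.more) (.seq (fetch .src) (.ite (fun v => v.2.more)
    (.seq markPass (.seq (clear .key) (.seq copySource (.seq innerLoop
      (.blk (.load (fun v => (v.1, { v.2 with more := true })) .done))))))
    (.blk .done)))

/-- The bound `n` stays fixed while the source shrinks, so that the cost per letter is the same
throughout the induction. -/
theorem exec_outerLoop (U V : List (List Bool)) (μ m : List Bool → Bool × Bool) (n : ℕ)
    (hn : tapeLength U ≤ n) {c u' : List Cell} {i : List TermSymbol} {o : List ω} {a s k : Bool} :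
    ∃ (m' : List Bool → Bool × Bool) (a' s' : Bool), Exec outerLoop (none, ⟨none, true, a, s, k, true⟩)
      ⟨i, o, stk c (tapeString (U.map fun z => (z, μ z))) (tapeString (V.map fun z => (z, m z))) u'
        [] [] [] []⟩
      (none, ⟨none, true, a', s', k && covered U V, false⟩)
      ⟨i, o, stk c [] (tapeString (V.map fun z => (z, m' z))) u' [] [] [] []⟩
      (tapeLength U * ((n + 1) * (8 * tapeLength V + 50)) + 9) := by
  induction U generalizing m a s k with
  | nil =>
    refine ⟨_, a, s, (Exec.loop_true rfl (Exec.seq exec_fetch_src_nil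
      (Exec.ite_false rfl (Exec.block rfl))) (Exec.loop_false rfl)).congr ?_ rfl ?_⟩
    · simp [covered]
    · simp
  | cons x R ih =>
    rw [tapeLength_cons] at hn
    have h1 := fun a s => exec_pass (ω := ω) (updM := fun e _ => (e, false))
      (updF := fun _ _ s => s) x m V (c := c) (u := tapeString (R.map fun z => (z, μ z))) (u' := u')
      (b := []) (i := i) (o := o) (x := none) (x' := none)
      (e := true) (a := a) (s := s) (k := k) (mo := true)
    have hf : ∀ L : List (List Bool), L.foldl (fun (s : Bool × Bool) _ => s) (false, false) =
        (false, false) := by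
      intro L
      induction L with
      | nil => rfl
      | cons _ L ih => exact ih
    simp only [hf] at h1
    obtain ⟨m₁, a₁, s₁, h2⟩ := exec_innerLoop (ω := ω) x [] R V μ (c := c)
      (u := tapeString (R.map fun z => (z, μ z))) (u' := u') (i := i) (o := o) (a := false)
      (s := false) (k := k)
    obtain ⟨m', a', s', h3⟩ := ih m₁ (by omega) (a := a₁) (s := s₁) (k := k && coveredFrom x [] R V)
    refine ⟨m', a', s', ?_⟩
    rw [List.map_cons, tapeString_cons]
    have h4 := exec_clear (ι := TermSymbol) (ω := ω) Stk.key
      (none, (⟨none, true, false, false, k, true⟩ : Flags))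
      ⟨i, o, stk c (tapeString (R.map fun z => (z, μ z)))
        (tapeString (V.map fun z => (z, (z == x, false)))) u' [] [] (x.map bitCell) []⟩
    simp only [update_key] at h4
    refine Exec.congr (Exec.loop_true rfl (Exec.seq (exec_fetch_src_cons x (μ x)) (Exec.ite_true rfl
      (Exec.seq (h1 a s) (Exec.seq h4
        (Exec.seq exec_copySource (Exec.seq h2 (Exec.block rfl))))))) h3) ?_ rfl ?_
    · simp [covered, Bool.and_assoc]
    · rw [tapeLength_cons]
      simp [length_tapeString]
      have e1 : (tapeLength R + 1) * (8 * tapeLength V + 50) ≤ (n + 1) * (8 * tapeLength V + 50) :=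
        Nat.mul_le_mul_right _ (by omega)
      have e2 : x.length * 6 ≤ x.length * ((n + 1) * (8 * tapeLength V + 50)) :=
        Nat.mul_le_mul_left _ (by nlinarith)
      nlinarith

end

end CoverMachine

namespace CoverMachine

open StackProgram

/-! #### Reading the input -/

/-- The string on a stack for a symbol of the input. -/
def letterCells : TermSymbol → List Cell
  | .var => [.mark (false, false)]
  | .bit b => [bitCell b]
  | _ => []

theorem length_letterCells (w : List TermSymbol) : (w.flatMap letterCells).length ≤ w.length := by
  induction w with
  | nil => simp
  | cons c w ih =>
    have h : (letterCells c).length ≤ 1 := by cases c <;> simp [letterCells]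
    rw [List.flatMap_cons, List.length_append, List.length_cons]
    omega

/-- The letter of a framed word as a string of bits. -/
def letterBits : Option ℕ → List Bool
  | none => [false]
  | some n => (Computability.encodeNat n).reverse

/-- The binary notation of a number is empty or contains its leading `1`, so the string `[false]` is
free to denote the marker. -/
theorem letterBits_injective : Function.Injective letterBits := by
  have h : ∀ n, letterBits none ≠ letterBits (some n) := by
    intro n hn
    have h1 : Computability.encodeNat n = [false] := by
      rw [← List.reverse_reverse (Computability.encodeNat n)]
      exact congrArg List.reverse hn.symm
    have h2 := Computability.decode_encodeNat n
    rw [h1] at h2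
    have h3 : n = 2 ∨ n = 0 := by
      revert h2
      simp [Computability.decodeNat, Computability.decodePosNum, Computability.decodeNum]
      omega
    rcases h3 with rfl | rfl
    · revert h1; decide
    · revert h1; decide
  rintro (_ | a) (_ | b) hab
  · rfl
  · exact (h b hab).elim
  · exact (h a hab.symm).elim
  · have h1 := congrArg Computability.decodeNat (List.reverse_injective hab)
    rw [Computability.decode_encodeNat, Computability.decode_encodeNat] at h1
    rw [h1]

/-- Pushing reverses the input: the symbol `var` of each letter comes after its bits and serves as
end mark, and the leaves appear in reverse order. This is why `binaryWord` is a reversed word. -/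
theorem reverse_flatMap_letterCells (p : SemigroupTerm) :
    (p.encode.flatMap letterCells).reverse =
      tapeString (p.leaves.reverse.map fun n => (letterBits (some n), (false, false))) := by
  induction p with
  | var n =>
    simp only [SemigroupTerm.encode, encodeVar, SemigroupTerm.leaves, tapeString, letterBits]
    have h : ∀ l : List Bool, (l.map TermSymbol.bit).flatMap letterCells = l.map bitCell := by
      intro l
      induction l with
      | nil => rfl
      | cons b l ih => simp [letterCells, ih]
    simp [h, letterCells]
  | mul p q ihp ihq =>
    simp only [SemigroupTerm.encode, SemigroupTerm.leaves, List.flatMap_cons, List.flatMap_append,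
      List.reverse_append, ihp, ihq, letterCells, tapeString, List.map_append]
    simp

/-- The reversed framed word of a term, with letters written in binary. -/
def binaryWord (p : SemigroupTerm) : List (List Bool) :=
  (framed p.leaves).reverse.map letterBits

theorem covered_binaryWord_iff (p q : SemigroupTerm) :
    covered (binaryWord p) (binaryWord q) = true ↔
      FactorsCovered (framed p.leaves) (framed q.leaves) := by
  rw [covered_eq_true_iff, binaryWord, binaryWord, factorsCovered_map_iff letterBits_injective,
    factorsCovered_reverse_iff]

/-- The string of a framed word. -/
theorem tapeString_binaryWord (p : SemigroupTerm) :
    tapeString ((binaryWord p).map fun z => (z, (false, false))) =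
      bitCell false :: .mark (false, false) ::
        ((p.encode.flatMap letterCells).reverse ++ [bitCell false, .mark (false, false)]) := by
  rw [reverse_flatMap_letterCells]
  simp [tapeString, binaryWord, framed, letterBits, Function.comp_def]

theorem tapeLength_binaryWord_le (p : SemigroupTerm) :
    tapeLength (binaryWord p) ≤ p.encode.length + 4 := by
  have h := length_letterCells p.encode
  rw [← length_tapeString (binaryWord p) fun _ => (false, false), tapeString_binaryWord]
  simp only [List.length_cons, List.length_append, List.length_reverse, List.length_nil]
  omega

theorem ne_sep_of_mem_encode {p : SemigroupTerm} {c : TermSymbol} (hc : c ∈ p.encode) :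
    c ≠ .sep := by
  induction p with
  | var n =>
    simp only [SemigroupTerm.encode, encodeVar, List.mem_cons, List.mem_map] at hc
    rcases hc with rfl | ⟨b, -, rfl⟩ <;> simp
  | mul p q ihp ihq =>
    simp only [SemigroupTerm.encode, List.mem_cons, List.mem_append] at hc
    rcases hc with rfl | hc | hc
    · simp
    · exact ihp hc
    · exact ihq hc

section

variable {ω : Type}

/-- Store an input symbol in the register. -/
@[simp]
def readReg (v : St) (o : Option TermSymbol) : St := (o.map .sym, v.2)

/-- There is a symbol in the register, and it is not `sep`. -/
def isTermSymbol : Option Cell → Bool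
  | none => false
  | some (.sym .sep) => false
  | _ => true

/-- Push the string for the symbol in the register. -/
def pushLetter (a : Stk) (b : Block St TermSymbol ω Stk Cell) : Block St TermSymbol ω Stk Cell :=
  .branch (fun v => match v.1 with | some (.sym .var) => true | _ => false)
    (.push a (fun _ => .mark (false, false)) b)
    (.branch (fun v => match v.1 with | some (.sym (.bit _)) => true | _ => false)
      (.push a reg b) b)

/-- Read a term and push its letters. -/
def readLoop (a : Stk) : Program ω :=
  .loop (fun v => isTermSymbol v.1)
    (.blk (pushLetter a (.push .cpy reg (.read readReg .done))))

theorem exec_readLoop {a : Stk} (ha : a ≠ .cpy) (w r : List TermSymbol) (hw : ∀ c ∈ w, c ≠ .sep)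
    (hr : ∀ c ∈ r.head?, c = .sep) (f : Flags) (o : List ω) (W : Stk → List Cell) :
    Exec (readLoop a) ((w ++ r).head?.map .sym, f) ⟨(w ++ r).tail, o, W⟩ (r.head?.map .sym, f)
      ⟨r.tail, o, Function.update (Function.update W a ((w.flatMap letterCells).reverse ++ W a))
        .cpy ((w.map .sym).reverse ++ W .cpy)⟩ (2 * w.length + 1) := by
  induction w generalizing W with
  | nil =>
    refine (Exec.loop_false ?_).congr rfl (by simp) (by simp)
    rcases r with _ | ⟨c, r⟩
    · rfl
    · obtain rfl := hr c (by simp)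
      rfl
  | cons c w ih =>
    have hc := hw c (by simp)
    have h1 : Exec (.blk (pushLetter a (.push .cpy reg (.read readReg .done))) : Program ω)
        (some (.sym c), f) ⟨w ++ r, o, W⟩ ((w ++ r).head?.map .sym, f) ⟨(w ++ r).tail, o,
          Function.update (Function.update W a ((letterCells c).reverse ++ W a))
            .cpy (.sym c :: W .cpy)⟩ 1 := by
      apply Exec.block
      cases c <;> simp [pushLetter, letterCells, ha.symm]
    refine Exec.congr (Exec.loop_true ?_ h1 (ih (fun d hd => hw d (by simp [hd])) _)) rfl ?_ ?_
    · cases c <;> first | rfl | exact absurd rfl hc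
    · refine congrArg (Store.mk _ _) (funext fun k => ?_)
      by_cases h1 : k = .cpy
      · subst h1
        simp
      · by_cases h2 : k = a
        · subst h2
          simp [ha]
        · simp [h1, h2]
    · simp
      omega

/-- Read a term and push its framed word. -/
def readTerm (a : Stk) : Program ω :=
  .seq (.blk (.push a (fun _ => .mark (false, false)) (.push a (fun _ => bitCell false)
    (.read readReg .done)))) (.seq (readLoop a)
      (.blk (.push a (fun _ => .mark (false, false)) (.push a (fun _ => bitCell false) .done))))

theorem exec_readTerm {a : Stk} (ha : a ≠ .cpy) (p : SemigroupTerm) (r : List TermSymbol)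
    (hr : ∀ c ∈ r.head?, c = .sep) (x : Option Cell) (f : Flags) (o : List ω) (W : Stk → List Cell)
    (hW : W a = []) :
    Exec (readTerm a) (x, f) ⟨p.encode ++ r, o, W⟩ (r.head?.map .sym, f)
      ⟨r.tail, o, Function.update
        (Function.update W a (tapeString ((binaryWord p).map fun z => (z, (false, false)))))
        .cpy ((p.encode.map .sym).reverse ++ W .cpy)⟩ (2 * p.encode.length + 3) := by
  have h1 : Exec (.blk (.push a (fun _ => .mark (false, false)) (.push a (fun _ => bitCell false)
      (.read readReg .done))) : Program ω) (x, f) ⟨p.encode ++ r, o, W⟩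
      ((p.encode ++ r).head?.map .sym, f) ⟨(p.encode ++ r).tail, o,
        Function.update W a [bitCell false, .mark (false, false)]⟩ 1 :=
    Exec.block (by simp [hW])
  refine (Exec.seq h1 (Exec.seq (exec_readLoop ha p.encode r (fun c hc => ne_sep_of_mem_encode hc)
    hr f o _) (Exec.block rfl))).congr rfl ?_ (by omega)
  refine congrArg (Store.mk _ _) (funext fun k => ?_)
  by_cases h1 : k = .cpy
  · subst h1
    simp [ha.symm]
  · by_cases h2 : k = a
    · subst h2
      simp [ha, ha.symm, tapeString_binaryWord]
    · simp [h1, h2]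

/-! #### The decision procedure -/

/-- Read two terms and decide whether the factors of each are covered by the other. -/
def decideCovered : Program ω :=
  .seq (readTerm .src) (.seq (.blk (.push .cpy reg .done)) (.seq copySource (.seq (move .rest .back)
    (.seq (move .back .alt) (.seq (readTerm .tape) (.seq outerLoop (.seq (move .tape .back)
      (.seq (move .back .src) (.seq (move .alt .back) (.seq (move .back .tape)
        (.seq (.blk (.load (fun v => (v.1, { v.2 with more := true })) .done))
          (.seq outerLoop (clear .tape)))))))))))))

theorem exec_move_stk {a b : Stk} (hab : a ≠ b) (x : Option Cell) (f : Flags) (i : List TermSymbol)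
    (o : List ω) (W W' : Stk → List Cell)
    (hW : Function.update (Function.update W a []) b ((W a).reverse ++ W b) = W') :
    Exec (move a b) (x, f) ⟨i, o, W⟩ (none, f) ⟨i, o, W'⟩ (2 * (W a).length + 2) := by
  subst hW
  exact exec_move hab (x, f) ⟨i, o, W⟩

/-- The first check consumes the source, so a copy of it waits on `.alt`; afterwards the two words
exchange roles. The whole input stays on `.cpy`, because the reduction to `G` may have to output it
again. -/
theorem exec_decideCovered (p q : SemigroupTerm) (o : List ω) :
    ∃ a s, Exec decideCovered (none, ⟨none, true, false, false, true, true⟩)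
      ⟨p.encode ++ .sep :: q.encode, o, fun _ => []⟩
      (none, ⟨none, true, a, s, covered (binaryWord p) (binaryWord q) &&
        covered (binaryWord q) (binaryWord p), false⟩)
      ⟨[], o, stk ((p.encode ++ .sep :: q.encode).map Cell.sym).reverse [] [] [] [] [] [] []⟩
      (1000 * ((p.encode ++ .sep :: q.encode).length + 3) ^ 3) := by
  set U := binaryWord p with hU
  set V := binaryWord q with hV
  have lU := tapeLength_binaryWord_le p
  have lV := tapeLength_binaryWord_le q
  rw [← hU] at lU
  rw [← hV] at lV
  set TU := tapeString (U.map fun z => (z, (false, false))) with hTU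
  set TV := tapeString (V.map fun z => (z, (false, false))) with hTV
  have lTU : TU.length = tapeLength U := length_tapeString U _
  have lTV : TV.length = tapeLength V := length_tapeString V _
  set f : Flags := ⟨none, true, false, false, true, true⟩ with hf
  set c := (p.encode.map Cell.sym).reverse with hc
  set c' := ((p.encode ++ .sep :: q.encode).map Cell.sym).reverse with hc'
  have h1 := exec_readTerm (ω := ω) (a := .src) (by decide) p (.sep :: q.encode) (by simp) none f o
    (stk [] [] [] [] [] [] [] []) rfl
  rw [← hU, ← hTU] at h1
  simp only [update_src, update_cpy, stk_cpy, List.append_nil, ← hc, List.head?_cons,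
    Option.map_some, List.tail_cons] at h1
  have h2 : Exec (.blk (.push .cpy reg .done) : Program ω) (some (.sym .sep), f)
      ⟨q.encode, o, stk c TU [] [] [] [] [] []⟩ (some (.sym .sep), f)
      ⟨q.encode, o, stk (.sym .sep :: c) TU [] [] [] [] [] []⟩ 1 := Exec.block (by simp)
  have h3 := exec_copySource (ω := ω) (c := .sym .sep :: c) (u := TU) (v := []) (u' := []) (y := [])
    (i := q.encode) (o := o) (x := some (.sym .sep)) (f := f)
  have h4 := exec_move_stk (ω := ω) (a := .rest) (b := .back) (by decide) none f q.encode o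
    (stk (.sym .sep :: c) TU [] [] TU [] [] []) (stk (.sym .sep :: c) TU [] [] [] TU.reverse [] [])
    (by simp)
  have h5 := exec_move_stk (ω := ω) (a := .back) (b := .alt) (by decide) none f q.encode o
    (stk (.sym .sep :: c) TU [] [] [] TU.reverse [] []) (stk (.sym .sep :: c) TU [] TU [] [] [] [])
    (by simp)
  have h6 := exec_readTerm (ω := ω) (a := .tape) (by decide) q [] (by simp) none f o
    (stk (.sym .sep :: c) TU [] TU [] [] [] []) rfl
  have e1 : (q.encode.map Cell.sym).reverse ++ .sym .sep :: c = c' := by simp [hc, hc']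
  rw [← hV, ← hTV, List.append_nil] at h6
  simp only [update_tape, update_cpy, stk_cpy, e1, List.head?_nil, Option.map_none,
    List.tail_nil] at h6
  obtain ⟨m₁, a₁, s₁, h7⟩ := exec_outerLoop (ω := ω) U V (fun _ => (false, false))
    (fun _ => (false, false)) _ le_rfl (c := c') (u' := TU) (i := []) (o := o) (a := false)
    (s := false) (k := true)
  set TV' := tapeString (V.map fun z => (z, m₁ z)) with hTV'
  have lTV' : TV'.length = tapeLength V := length_tapeString V _
  set f₁ : Flags := ⟨none, true, a₁, s₁, true && covered U V, false⟩ with hf₁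
  have h8 := exec_move_stk (ω := ω) (a := .tape) (b := .back) (by decide) none f₁ [] o
    (stk c' [] TV' TU [] [] [] []) (stk c' [] [] TU [] TV'.reverse [] []) (by simp)
  have h9 := exec_move_stk (ω := ω) (a := .back) (b := .src) (by decide) none f₁ [] o
    (stk c' [] [] TU [] TV'.reverse [] []) (stk c' TV' [] TU [] [] [] []) (by simp)
  have h10 := exec_move_stk (ω := ω) (a := .alt) (b := .back) (by decide) none f₁ [] o
    (stk c' TV' [] TU [] [] [] []) (stk c' TV' [] [] [] TU.reverse [] []) (by simp)
  have h11 := exec_move_stk (ω := ω) (a := .back) (b := .tape) (by decide) none f₁ [] o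
    (stk c' TV' [] [] [] TU.reverse [] []) (stk c' TV' TU [] [] [] [] []) (by simp)
  obtain ⟨m₂, a₂, s₂, h12⟩ := exec_outerLoop (ω := ω) V U m₁ (fun _ => (false, false)) _ le_rfl
    (c := c') (u' := []) (i := []) (o := o) (a := a₁) (s := s₁) (k := true && covered U V)
  have h13 := exec_clear (ι := TermSymbol) (ω := ω) Stk.tape
    (none, (⟨none, true, a₂, s₂, true && covered U V && covered V U, false⟩ : Flags))
    ⟨[], o, stk c' [] (tapeString (U.map fun z => (z, m₂ z))) [] [] [] [] []⟩
  simp only [update_tape] at h13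
  refine ⟨a₂, s₂, ?_⟩
  rw [← stk_nil]
  refine Exec.congr (Exec.seq h1 (Exec.seq h2 (Exec.seq h3 (Exec.seq h4 (Exec.seq h5 (Exec.seq h6
    (Exec.seq h7 (Exec.seq h8 (Exec.seq h9 (Exec.seq h10 (Exec.seq h11 (Exec.seq (Exec.block rfl)
      (Exec.seq h12 h13))))))))))))) ?_ rfl ?_
  · simp
  · simp only [stk_tape, stk_back, stk_alt, stk_rest, List.length_reverse, lTU, lTV',
      length_tapeString, List.length_append, List.length_cons]
    -- The summand `3` makes `N` at least both tape lengths. The two outer loops then cost a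
    -- multiple of `N ^ 3`, and everything else is linear.
    set N := p.encode.length + (q.encode.length + 1) + 3 with hN
    have e2 : tapeLength U * ((tapeLength U + 1) * (8 * tapeLength V + 50)) ≤
        N * ((2 * N) * (21 * N)) := by gcongr <;> omega
    have e3 : tapeLength V * ((tapeLength V + 1) * (8 * tapeLength U + 50)) ≤
        N * ((2 * N) * (21 * N)) := by gcongr <;> omega
    have e4 : N * ((2 * N) * (21 * N)) = 42 * N ^ 3 := by ring
    have e5 : N ≤ N ^ 3 := Nat.le_self_pow (by decide) N
    rw [e4] at e2 e3
    omega

end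

end CoverMachine

/-- A semigroup term as a group term. -/
def SemigroupTerm.toGroupTerm : SemigroupTerm → GroupTerm
  | .var n => .var n
  | .mul p q => .mul p.toGroupTerm q.toGroupTerm

theorem SemigroupTerm.encode_toGroupTerm (p : SemigroupTerm) :
    p.toGroupTerm.encode = p.encode := by
  induction p with
  | var n => rfl
  | mul p q ihp ihq => simp [toGroupTerm, GroupTerm.encode, SemigroupTerm.encode, ihp, ihq]

theorem SemigroupTerm.eval_toGroupTerm {G : Type u} [Group G] (e : ℕ → G) (p : SemigroupTerm) :
    p.toGroupTerm.eval e = (p.leaves.map e).prod := by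
  induction p with
  | var n => simp [toGroupTerm, GroupTerm.eval, leaves]
  | mul p q ihp ihq => simp [toGroupTerm, GroupTerm.eval, leaves, ihp, ihq]

/-! ### Programs for the reduction to group terms and for deciding coverage -/

namespace CoverMachine

open StackProgram

/-- Decide whether the factors of the words of two terms cover each other. -/
def coveredPair (pq : SemigroupTerm × SemigroupTerm) : Bool :=
  covered (binaryWord pq.1) (binaryWord pq.2) && covered (binaryWord pq.2) (binaryWord pq.1)

theorem coveredPair_eq_true_iff (pq : SemigroupTerm × SemigroupTerm) :
    coveredPair pq = true ↔ FactorsCovered (framed pq.1.leaves) (framed pq.2.leaves) ∧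
      FactorsCovered (framed pq.2.leaves) (framed pq.1.leaves) := by
  rw [coveredPair, Bool.and_eq_true, covered_binaryWord_iff, covered_binaryWord_iff]

/-- The pair of semigroup terms as group terms if their factors cover each other, and a pair of
terms which differ on nontrivial groups otherwise. -/
def groupPair (pq : SemigroupTerm × SemigroupTerm) : GroupTerm × GroupTerm :=
  if coveredPair pq then (pq.1.toGroupTerm, pq.2.toGroupTerm) else (.var 0, .one)

/-- The input symbol in a register. -/
def symbolOf (v : St) : TermSymbol :=
  match v.1 with
  | some (.sym c) => c
  | _ => .sep

/-- Write the copy of the input. -/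
def writeCopy : Program TermSymbol :=
  .seq (.blk (.pop .cpy setReg .done))
    (.loop (fun v => v.1.isSome) (.blk (.write symbolOf (.pop .cpy setReg .done))))

theorem exec_writeCopy (w : List TermSymbol) (x : Option Cell) (f : Flags) (i o : List TermSymbol) :
    Exec writeCopy (x, f) ⟨i, o, stk (w.map Cell.sym) [] [] [] [] [] [] []⟩ (none, f)
      ⟨i, w.reverse ++ o, stk [] [] [] [] [] [] [] []⟩ (2 * w.length + 2) := by
  have key : ∀ (w o : List TermSymbol),
      Exec (.loop (fun v => v.1.isSome) (.blk (.write symbolOf (.pop .cpy setReg .done))) :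
        Program TermSymbol) ((w.map Cell.sym).head?, f)
        ⟨i, o, stk (w.map Cell.sym).tail [] [] [] [] [] [] []⟩ (none, f)
        ⟨i, w.reverse ++ o, stk [] [] [] [] [] [] [] []⟩ (2 * w.length + 1) := by
    intro w
    induction w with
    | nil => exact fun o => Exec.loop_false rfl
    | cons c w ih =>
      intro o
      refine (Exec.loop_true rfl (Exec.block ?_) (ih (c :: o))).congr rfl ?_ ?_
      · simp [symbolOf]
      · simp
      · simp
        omega
  exact (Exec.seq (Exec.block (by simp)) (key w o)).congr rfl rfl (by omega)

/-- The program computing `groupPair`. -/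
def groupPairProgram : Program TermSymbol :=
  .seq decideCovered (.ite (fun v => v.2.ok) writeCopy (.seq (clear .cpy)
    (.blk (.write (fun _ => .one) (.write (fun _ => .sep) (.write (fun _ => .var) .done))))))

theorem groupPair_computable :
    Nonempty (Turing.TM2ComputableInPolyTime
      (fun pq : SemigroupTerm × SemigroupTerm => pq.1.encode ++ TermSymbol.sep :: pq.2.encode)
      (fun st : GroupTerm × GroupTerm => st.1.encode ++ TermSymbol.sep :: st.2.encode)
      groupPair) := by
  refine computableInPolyTime_of_exec groupPairProgram
    (none, (⟨none, true, false, false, true, true⟩ : Flags))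
    (Polynomial.C 1010 * (Polynomial.X + 3) ^ 3) fun pq => ?_
  obtain ⟨a, s, h⟩ := exec_decideCovered pq.1 pq.2 ([] : List TermSymbol)
  set inp := pq.1.encode ++ TermSymbol.sep :: pq.2.encode with hinp
  change Exec _ _ _ (none, (⟨none, true, a, s, coveredPair pq, false⟩ : Flags)) _ _ at h
  refine ⟨(none, ⟨none, true, a, s, coveredPair pq, false⟩), ?_⟩
  rw [← stk_nil] at h ⊢
  have ht : inp.length + 3 ≤ (inp.length + 3) ^ 3 := Nat.le_self_pow (by decide) _
  have he : (Polynomial.C 1010 * (Polynomial.X + 3) ^ 3 : Polynomial ℕ).eval inp.length =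
      1010 * (inp.length + 3) ^ 3 := by simp
  rw [he]
  by_cases hc : coveredPair pq = true
  · rw [← List.map_reverse] at h
    refine Exec.congr (Exec.seq h (Exec.ite_true hc (exec_writeCopy inp.reverse _ _ _ _))) rfl ?_ ?_
    · simp [groupPair, hc, SemigroupTerm.encode_toGroupTerm, hinp]
    · rw [List.length_reverse]
      omega
  · have h1 := exec_clear (ι := TermSymbol) (ω := TermSymbol) Stk.cpy
      (none, (⟨none, true, a, s, coveredPair pq, false⟩ : Flags))
      ⟨[], [], stk (inp.map Cell.sym).reverse [] [] [] [] [] [] []⟩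
    rw [update_cpy] at h1
    refine Exec.congr (Exec.seq h (Exec.ite_false (Bool.eq_false_of_not_eq_true hc)
      (Exec.seq h1 (Exec.block rfl)))) rfl ?_ ?_
    · have h0 : (GroupTerm.var 0).encode = [.var] := by
        simp [GroupTerm.encode, encodeVar, Computability.encodeNat, Computability.encodeNum]
      simp [groupPair, hc, h0, GroupTerm.encode]
    · simp only [stk_cpy, List.length_reverse, List.length_map]
      omega

/-- The program computing `coveredPair`. -/
def coveredPairProgram : Program Bool :=
  .seq decideCovered (.seq (clear .cpy) (.blk (.write (fun v => v.2.ok) .done)))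

theorem coveredPair_computable :
    Nonempty (Turing.TM2ComputableInPolyTime
      (fun pq : SemigroupTerm × SemigroupTerm => pq.1.encode ++ TermSymbol.sep :: pq.2.encode)
      Computability.encodeBool coveredPair) := by
  refine computableInPolyTime_of_exec coveredPairProgram
    (none, (⟨none, true, false, false, true, true⟩ : Flags))
    (Polynomial.C 1010 * (Polynomial.X + 3) ^ 3) fun pq => ?_
  obtain ⟨a, s, h⟩ := exec_decideCovered pq.1 pq.2 ([] : List Bool)
  set inp := pq.1.encode ++ TermSymbol.sep :: pq.2.encode with hinp
  change Exec _ _ _ (none, (⟨none, true, a, s, coveredPair pq, false⟩ : Flags)) _ _ at h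
  refine ⟨(none, ⟨none, true, a, s, coveredPair pq, false⟩), ?_⟩
  rw [← stk_nil] at h ⊢
  have ht : inp.length + 3 ≤ (inp.length + 3) ^ 3 := Nat.le_self_pow (by decide) _
  have he : (Polynomial.C 1010 * (Polynomial.X + 3) ^ 3 : Polynomial ℕ).eval inp.length =
      1010 * (inp.length + 3) ^ 3 := by simp
  rw [he]
  have h1 := exec_clear (ι := TermSymbol) (ω := Bool) Stk.cpy
    (none, (⟨none, true, a, s, coveredPair pq, false⟩ : Flags))
    ⟨[], [], stk (inp.map Cell.sym).reverse [] [] [] [] [] [] []⟩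
  rw [update_cpy] at h1
  refine Exec.congr (Exec.seq h (Exec.seq h1 (Exec.block rfl))) rfl rfl ?_
  simp only [stk_cpy, List.length_reverse, List.length_map]
  omega

end CoverMachine

/-! ### The two reductions and the trivial group -/

namespace CornerZero

open CoverMachine

theorem forall_eval_eq_iff_coveredPair (G : Type u) [Group G]
    (pq : SemigroupTerm × SemigroupTerm) :
    (∀ e : ℕ → TranslationalHull (Rees G), pq.1.eval e = pq.2.eval e) ↔
      (∀ e : ℕ → G, pq.1.toGroupTerm.eval e = pq.2.toGroupTerm.eval e) ∧
        coveredPair pq = true := by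
  rw [forall_eval_eq_iff_factorsCovered, coveredPair_eq_true_iff]
  simp only [SemigroupTerm.eval_toGroupTerm]

theorem groupTermEq_polyReducible (G : Type u) [Group G] [Finite G] :
    (groupTermEq G).PolyReducible (semigroupTermEq (TranslationalHull (Rees G))) := by
  -- The exponent depends only on `G`, so for the machine it is a constant.
  have hm : ∀ g : G, g ^ (Nat.card G - 1) = g⁻¹ := by
    intro g
    have h : g ^ (Nat.card G - 1) * g = 1 := by
      rw [← pow_succ, Nat.sub_add_cancel Nat.card_pos, pow_card_eq_one']
    exact eq_inv_of_mul_eq_one_left h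
  exact ⟨powerPair (Nat.card G - 1), GroupTermMachine.powerPair_computable _, powerPair_correct hm⟩

/-- If coverage fails, the output is the pair `x_0`, `1`, and an element other than `1` makes it a
no-instance; nontriviality is used only here. -/
theorem polyReducible_groupTermEq (G : Type u) [Group G] [Nontrivial G] :
    (semigroupTermEq (TranslationalHull (Rees G))).PolyReducible (groupTermEq G) := by
  refine ⟨groupPair, groupPair_computable, fun pq => ?_⟩
  refine (forall_eval_eq_iff_coveredPair G pq).trans ?_
  change _ ↔ ∀ e : ℕ → G, (groupPair pq).1.eval e = (groupPair pq).2.eval e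
  by_cases hc : coveredPair pq = true
  · simp [groupPair, hc]
  · obtain ⟨g, hg⟩ := exists_ne (1 : G)
    refine iff_of_false (fun h => hc h.2) fun h => hg ?_
    simpa [groupPair, hc, GroupTerm.eval] using h fun _ => g

/-- All identities hold in a trivial group, so the condition on `G` is void and coverage alone
decides. -/
theorem inP_of_subsingleton (G : Type u) [Group G] [Subsingleton G] :
    (semigroupTermEq (TranslationalHull (Rees G))).InP :=
  ⟨coveredPair, coveredPair_computable, fun pq => (forall_eval_eq_iff_coveredPair G pq).trans
    (and_iff_right fun _ => Subsingleton.elim _ _)⟩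

end CornerZero

theorem lemma5p5 (G : Type u) [Group G] [Finite G] :
    (Nontrivial G →
      (semigroupTermEq (TranslationalHull (ReesMatrixSemigroup (cornerZeroMatrix G)))).PolyEquivalent
        (groupTermEq G)) ∧
    (Subsingleton G →
      (groupTermEq G).PolyReducible
        (semigroupTermEq (TranslationalHull (ReesMatrixSemigroup (cornerZeroMatrix G)))) ∧
      (semigroupTermEq (TranslationalHull (ReesMatrixSemigroup (cornerZeroMatrix G)))).InP) :=
  ⟨fun _ => ⟨CornerZero.polyReducible_groupTermEq G, CornerZero.groupTermEq_polyReducible G⟩,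
    fun _ => ⟨CornerZero.groupTermEq_polyReducible G, CornerZero.inP_of_subsingleton G⟩⟩
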